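/- Let $\mathbb K$ be $\mathbb R$ or $\mathbb C$. For Banach spaces $X_1,\dots,X_n$ ($n\ge 1$) a reasonable crossnorm $\beta$ is a norm on $X_1\otimes\cdots\otimes X_n$ with $\varepsilon\le\beta\le\pi$ (injective and projective tensor norms); $\Sigma_X$ is the set of decomposable tensors, and $\mathcal L^\beta(X_1,\dots,X_n):=(X_1\otimes\cdots\otimes X_n,\beta)^*$ with norm $\|\cdot\|_\beta$. An election $(n,X_1,\dots,X_n,Y,\beta)$ consists of $n\geq 1$, Banach spaces $X_i,Y$ and a reasonable crossnorm $\beta$. For subspaces $E_i\subset X_i$, $\beta|$ is the restriction of $\beta$ to $E_1\otimes\cdots\otimes E_n$. $\mathcal F(V)$ denotes the finite dimensional subspaces of $V$ and $\mathcal{CF}(V)$ the closed finite codimensional ones; $Q_L:Y\to Y/L$ is the quotient map. For a bounded multilinear operator $T$, $\tilde T$ is its linearization and $f_T=\tilde T|_{\Sigma_X}$. For $\varphi\in\mathcal L^\beta(X_1,\dots,X_n)$ and $y\in Y$, $\varphi\cdot y$ is the operator $(x_1,\dots,x_n)\mapsto\varphi(x_1\otimes\cdots\otimes x_n)\,y$.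 A $\Sigma$-tensor norm on duals $\nu$ assigns to each election a norm $\nu_\beta$ on $\mathcal L^\beta(X_1,\dots,X_n)\otimes Y$ such that: (D1) $\nu_\beta(\varphi\otimes y)\le\|\varphi\|_\beta\|y\|$; (D2) for $p,q\in\Sigma_X$ and $y^*\in Y^*$ the functional $\varphi\otimes y\mapsto(\varphi(p)-\varphi(q))y^*(y)$ has norm at most $\beta(p-q)\|y^*\|$; (D3) $\|A\otimes B\|\le\|A\|\|B\|$ (with respect to $\nu_\beta$ and $\nu_\theta$) for all bounded linear $B:Y\to W$ and $A:\mathcal L^\beta(X_1,\dots,X_n)\to\mathcal L^\theta(Z_1,\dots,Z_m)$ such that $A^*$ maps the canonical image of $\Sigma_Z$ in the bidual of $(Z_1\otimes\cdots\otimes Z_m,\theta)$ into that of $\Sigma_X$ in the bidual of $(X_1\otimes\cdots\otimes X_n,\beta)$. A $\Sigma$-ideal $[\mathcal A,A]$ assigns to each election a linear subspace $\mathcal A^\beta(X_1,\dots,X_n;Y)$ of $\mathcal L(X_1,\dots,X_n;Y)$ (the bounded multilinear operators) and a complete norm $A^\beta$ on it such that: (I1) $\varphi\cdot y\in\mathcal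 A^\beta(X_1,\dots,X_n;Y)$ and $A^\beta(\varphi\cdot y)\le\|\varphi\|_\beta\|y\|$ for $\varphi\in\mathcal L^\beta(X_1,\dots,X_n)$, $y\in Y$; (I2) $\|f_T(p)-f_T(q)\|\le A^\beta(T)\,\beta(p-q)$ for $T\in\mathcal A^\beta(X_1,\dots,X_n;Y)$ and $p,q\in\Sigma_X$; (I3) if $\tilde R:(Z_1\otimes\cdots\otimes Z_m,\theta)\to(X_1\otimes\cdots\otimes X_n,\beta)$ is bounded linear with $\tilde R(\Sigma_Z)\subset\Sigma_X$, $T\in\mathcal A^\beta(X_1,\dots,X_n;Y)$ and $S:Y\to W$ is bounded linear, then $U:(z_1,\dots,z_m)\mapsto S f_T(\tilde R(z_1\otimes\cdots\otimes z_m))$ is in $\mathcal A^\theta(Z_1,\dots,Z_m;W)$ and $A^\theta(U)\le\|\tilde R\|A^\beta(T)\|S\|$. It is maximal if it coincides with its maximal hull: for every election and every $T\in\mathcal L(X_1,\dots,X_n;Y)$, $T\in\mathcal A^\beta(X_1,\dots,X_n;Y)$ if and only if $$s(T):=\sup\{A^{\beta|}(Q_L\,T|_{E_1\times\cdots\times E_n})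 : E_i\in\mathcal F(X_i),\ L\in\mathcal{CF}(Y)\}<\infty,$$ and then $A^\beta(T)=s(T)$. It is associated to $\nu$ if for all elections of finite dimensional spaces $\varphi\otimes y\mapsto\varphi\cdot y$ is an isometric isomorphism of $(\mathcal L^\beta(E_1,\dots,E_n)\otimes F,\nu_\beta)$ onto $\mathcal A^\beta(E_1,\dots,E_n;F)$. The finitely generated $\Sigma$-tensor norm on spaces $\alpha$ defined by $\nu$ is given as follows. For finite dimensional spaces, $\alpha^\beta$ on $E_1\otimes\cdots\otimes E_n\otimes F$ is the norm of the dual $(\mathcal L^\beta(E_1,\dots,E_n)\otimes F^*,\nu_\beta)^*$, tensors acting by evaluation. In general $\alpha^\beta(u;X_1,\dots,X_n,Y)$ is the infimum of $\alpha^{\beta|}(u;E_1,\dots,E_n,F)$ over all $E_i\in\mathcal F(X_i)$, $F\in\mathcal F(Y)$ with $u\in E_1\otimes\cdots\otimes E_n\otimes F$. **Theorem (Representation Theorem for Maximal $\Sigma$-ideals).** Let $\nu$ be a $\Sigma$-tensor norm on duals, $[\mathcal A,A]$ the maximal $\Sigma$-ideal associated to $\nu$, and $\alpha$ the finitely generated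 $\Sigma$-tensor norm on spaces defined by $\nu$. Then for every election $(n,X_1,\dots,X_n,Y,\beta)$ of Banach spaces $$(X_1\otimes\cdots\otimes X_n\otimes Y,\alpha^\beta)^*=\mathcal A^\beta(X_1,\dots,X_n;Y^*)$$ holds linearly and isometrically, where $\phi$ corresponds to the operator $T_\phi$ with $T_\phi(x_1,\dots,x_n)(y)=\phi(x_1\otimes\cdots\otimes x_n\otimes y)$. Also $$(X_1\otimes\cdots\otimes X_n\otimes Y^*,\alpha^\beta)^*\cap\mathcal L(X_1,\dots,X_n;Y)=\mathcal A^\beta(X_1,\dots,X_n;Y)$$ holds linearly and isometrically. Here the left-hand side consists of the bounded functionals $\phi$ for which there is $T\in\mathcal L(X_1,\dots,X_n;Y)$ with $\phi(x_1\otimes\cdots\otimes x_n\otimes y^*)=y^*(T(x_1,\dots,x_n))$, carries the norm of the dual, and $\phi$ corresponds to $T$. -/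

import Mathlib

open scoped TensorProduct ENNReal

universe u

noncomputable section

namespace SigmaIdeals

/-! ### Reasonable crossnorms and the normed space `(X₁ ⊗ ⋯ ⊗ Xₙ, β)` -/

section Crossnorm

variable (𝕜 : Type) [RCLike 𝕜] {n : ℕ} (X : Fin n → Type u)
  [∀ i, NormedAddCommGroup (X i)] [∀ i, NormedSpace 𝕜 (X i)]

/-- The linear form `x₁* ⊗ ⋯ ⊗ xₙ*` on `X₁ ⊗ ⋯ ⊗ Xₙ`. -/
def tensorForm (f : ∀ i, StrongDual 𝕜 (X i)) : (⨂[𝕜] i, X i) →ₗ[𝕜] 𝕜 :=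
  PiTensorProduct.lift
    ((MultilinearMap.mkPiAlgebra 𝕜 (Fin n) 𝕜).compLinearMap fun i => (f i : X i →ₗ[𝕜] 𝕜))

/-- A reasonable crossnorm: a norm `β` on `X₁ ⊗ ⋯ ⊗ Xₙ` with `ε ≤ β ≤ π`, where `π` is the
projective norm and `ε u` is the supremum of `|x₁* ⊗ ⋯ ⊗ xₙ* (u)|` over functionals `xᵢ*` in the
dual unit balls. -/
structure ReasonableCrossnorm where
  /-- the norm -/
  toSeminorm : Seminorm 𝕜 (⨂[𝕜] i, X i)
  eq_zero : ∀ u, toSeminorm u = 0 → u = 0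
  injective_le : ∀ f : ∀ i, StrongDual 𝕜 (X i), (∀ i, ‖f i‖ ≤ 1) →
    ∀ u, ‖tensorForm 𝕜 X f u‖ ≤ toSeminorm u
  le_projective : ∀ u, toSeminorm u ≤ PiTensorProduct.projectiveSeminorm u

variable {𝕜 X}

/-- The algebraic tensor product `X₁ ⊗ ⋯ ⊗ Xₙ`, to be endowed with the norm `β`. -/
def CrossTensor (_β : ReasonableCrossnorm 𝕜 X) : Type u := ⨂[𝕜] i, X i

instance (β : ReasonableCrossnorm 𝕜 X) : AddCommGroup (CrossTensor β) :=
  inferInstanceAs (AddCommGroup (⨂[𝕜] i, X i))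

instance (β : ReasonableCrossnorm 𝕜 X) : Module 𝕜 (CrossTensor β) :=
  inferInstanceAs (Module 𝕜 (⨂[𝕜] i, X i))

instance (β : ReasonableCrossnorm 𝕜 X) : Norm (CrossTensor β) := ⟨fun u => β.toSeminorm u⟩

theorem crossTensor_core (β : ReasonableCrossnorm 𝕜 X) :
    NormedSpace.Core 𝕜 (CrossTensor β) where
  norm_nonneg u := apply_nonneg β.toSeminorm u
  norm_smul c u := map_smul_eq_mul β.toSeminorm c u
  norm_triangle u v := map_add_le_add β.toSeminorm u v
  norm_eq_zero_iff u := ⟨β.eq_zero u, fun h => by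
    rw [h]; exact map_zero β.toSeminorm⟩

instance (β : ReasonableCrossnorm 𝕜 X) : NormedAddCommGroup (CrossTensor β) :=
  NormedAddCommGroup.ofCore (crossTensor_core β)

instance (β : ReasonableCrossnorm 𝕜 X) : NormedSpace 𝕜 (CrossTensor β) :=
  NormedSpace.ofCore (crossTensor_core β)

/-- The decomposable tensor `x₁ ⊗ ⋯ ⊗ xₙ`, as a bounded multilinear map into
`(X₁ ⊗ ⋯ ⊗ Xₙ, β)`. -/
def tensor (β : ReasonableCrossnorm 𝕜 X) : ContinuousMultilinearMap 𝕜 X (CrossTensor β) :=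
  MultilinearMap.mkContinuous (G := CrossTensor β)
    (PiTensorProduct.tprod 𝕜 : MultilinearMap 𝕜 X (⨂[𝕜] i, X i)) 1 fun x => by
      rw [one_mul]
      exact (β.le_projective _).trans (PiTensorProduct.projectiveSeminorm_tprod_le x)

/-- The set `Σ` of decomposable tensors (the Segre cone). -/
def segre (β : ReasonableCrossnorm 𝕜 X) : Set (CrossTensor β) := Set.range (tensor β)

/-- `ℒ^β(X₁, …, Xₙ)`: the bounded linear forms on `(X₁ ⊗ ⋯ ⊗ Xₙ, β)`, which are the
linearizations of the multilinear forms `φ` with `‖φ‖_β < ∞`, normed by `‖φ‖_β`. -/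
abbrev Forms (β : ReasonableCrossnorm 𝕜 X) : Type u := StrongDual 𝕜 (CrossTensor β)

/-- The linearization of a multilinear operator; its restriction to the decomposable tensors is
the associated `Σ`-operator `f_T`. -/
def linearization (β : ReasonableCrossnorm 𝕜 X) {Y : Type u} [NormedAddCommGroup Y]
    [NormedSpace 𝕜 Y] (T : ContinuousMultilinearMap 𝕜 X Y) : CrossTensor β →ₗ[𝕜] Y :=
  (PiTensorProduct.lift T.toMultilinearMap : (⨂[𝕜] i, X i) →ₗ[𝕜] Y)

/-- The rank-one operator `φ · y`, `(x₁, …, xₙ) ↦ φ (x₁ ⊗ ⋯ ⊗ xₙ) y`. -/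
def rankOne (β : ReasonableCrossnorm 𝕜 X) {Y : Type u} [NormedAddCommGroup Y]
    [NormedSpace 𝕜 Y] (φ : Forms β) (y : Y) : ContinuousMultilinearMap 𝕜 X Y :=
  (φ.smulRight y).compContinuousMultilinearMap (tensor β)

/-- The linear map `ℒ^β(X₁, …, Xₙ) ⊗ Y → ℒ(X₁, …, Xₙ; Y)`, `φ ⊗ y ↦ φ · y`. -/
def toOperator (β : ReasonableCrossnorm 𝕜 X) (Y : Type u) [NormedAddCommGroup Y]
    [NormedSpace 𝕜 Y] : Forms β ⊗[𝕜] Y →ₗ[𝕜] ContinuousMultilinearMap 𝕜 X Y :=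
  TensorProduct.lift (LinearMap.mk₂ 𝕜 (rankOne β)
    (fun φ ψ y => by ext x; simp [rankOne, add_smul])
    (fun c φ y => by ext x; simp [rankOne, mul_smul])
    (fun φ y z => by ext x; simp [rankOne])
    (fun c φ y => by
      ext x
      simpa [rankOne] using smul_comm (φ (tensor β x)) c y))

/-- `R` is (the linearization of) a `Σ`-`β`-`θ`-operator: the multilinear operator
`(z₁, …, zₘ) ↦ R (z₁ ⊗ ⋯ ⊗ zₘ)` takes decomposable values. -/
def IsSigmaOperator {m : ℕ} {Z : Fin m → Type u} [∀ i, NormedAddCommGroup (Z i)]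
    [∀ i, NormedSpace 𝕜 (Z i)] {θ : ReasonableCrossnorm 𝕜 Z} {β : ReasonableCrossnorm 𝕜 X}
    (R : CrossTensor θ →L[𝕜] CrossTensor β) : Prop :=
  ∀ q ∈ segre θ, R q ∈ segre β

/-- `A : ℒ^β(X₁, …, Xₙ) → ℒ^θ(Z₁, …, Zₘ)` preserves `Σ`: its adjoint maps (the canonical image in
the bidual of) decomposable tensors to (canonical images of) decomposable tensors. -/
def PreservesSigma {m : ℕ} {Z : Fin m → Type u} [∀ i, NormedAddCommGroup (Z i)]
    [∀ i, NormedSpace 𝕜 (Z i)] {θ : ReasonableCrossnorm 𝕜 Z} {β : ReasonableCrossnorm 𝕜 X}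
    (A : Forms β →L[𝕜] Forms θ) : Prop :=
  ∀ q ∈ segre θ, ∃ p ∈ segre β,
    (NormedSpace.inclusionInDoubleDual 𝕜 (CrossTensor θ) q).comp A =
      NormedSpace.inclusionInDoubleDual 𝕜 (CrossTensor β) p

/-- For `v ∈ ℒ^β(X₁, …, Xₙ) ⊗ Y*`, the functional on `X₁ ⊗ ⋯ ⊗ Xₙ ⊗ Y` with
`φ ⊗ y* ↦ (w ⊗ y ↦ φ(w) y*(y))`. -/
def evaluation (β : ReasonableCrossnorm 𝕜 X) (Y : Type u) [NormedAddCommGroup Y]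
    [NormedSpace 𝕜 Y] :
    Forms β ⊗[𝕜] StrongDual 𝕜 Y →ₗ[𝕜] Module.Dual 𝕜 (CrossTensor β ⊗[𝕜] Y) :=
  TensorProduct.dualDistrib 𝕜 (CrossTensor β) Y ∘ₗ
    TensorProduct.map (ContinuousLinearMap.coeLM 𝕜) (ContinuousLinearMap.coeLM 𝕜)

/-- For `w ∈ X₁ ⊗ ⋯ ⊗ Xₙ` and `y* ∈ Y*`, the functional `w ⊗ y*` on `ℒ^β(X₁, …, Xₙ) ⊗ Y` with
`φ ⊗ y ↦ φ(w) y*(y)`. -/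
def evaluationAt {β : ReasonableCrossnorm 𝕜 X} {Y : Type u} [NormedAddCommGroup Y]
    [NormedSpace 𝕜 Y] (w : CrossTensor β) (g : StrongDual 𝕜 Y) :
    Module.Dual 𝕜 (Forms β ⊗[𝕜] Y) :=
  TensorProduct.dualDistrib 𝕜 (Forms β) Y
    ((NormedSpace.inclusionInDoubleDual 𝕜 (CrossTensor β) w : Forms β →ₗ[𝕜] 𝕜) ⊗ₜ[𝕜]
      (g : Y →ₗ[𝕜] 𝕜))

end Crossnorm

/-! ### Finite dimensional and finite codimensional subspaces -/

section Local

variable (𝕜 : Type) [RCLike 𝕜]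

/-- `ℱ(V)`: the finite dimensional subspaces of `V`. -/
def FinSub (V : Type u) [NormedAddCommGroup V] [NormedSpace 𝕜 V] : Type u :=
  {E : Submodule 𝕜 V // FiniteDimensional 𝕜 E}

/-- `𝒞ℱ(V)`: the closed subspaces of `V` of finite codimension. -/
def CofinSub (V : Type u) [NormedAddCommGroup V] [NormedSpace 𝕜 V] : Type u :=
  {L : Submodule 𝕜 V // IsClosed (L : Set V) ∧ FiniteDimensional 𝕜 (V ⧸ L)}

variable {𝕜}

instance {V : Type u} [NormedAddCommGroup V] [NormedSpace 𝕜 V] (E : FinSub 𝕜 V) :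
    FiniteDimensional 𝕜 E.1 := E.2

instance {V : Type u} [NormedAddCommGroup V] [NormedSpace 𝕜 V] (E : FinSub 𝕜 V) :
    CompleteSpace E.1 := FiniteDimensional.complete 𝕜 E.1

instance {V : Type u} [NormedAddCommGroup V] [NormedSpace 𝕜 V] (L : CofinSub 𝕜 V) :
    IsClosed (L.1 : Set V) := L.2.1

variable {n : ℕ} {X : Fin n → Type u} [∀ i, NormedAddCommGroup (X i)]
  [∀ i, NormedSpace 𝕜 (X i)]

/-- The inclusion `E₁ ⊗ ⋯ ⊗ Eₙ → X₁ ⊗ ⋯ ⊗ Xₙ`. -/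
def tensorIncl (E : ∀ i, FinSub 𝕜 (X i)) : (⨂[𝕜] i, (E i).1) →ₗ[𝕜] ⨂[𝕜] i, X i :=
  PiTensorProduct.map fun i => (E i).1.subtype

theorem tensorIncl_injective (E : ∀ i, FinSub 𝕜 (X i)) :
    Function.Injective (tensorIncl E) := by
  have h : ∀ i, ∃ g : X i →ₗ[𝕜] (E i).1, g ∘ₗ (E i).1.subtype = LinearMap.id := fun i =>
    LinearMap.exists_leftInverse_of_injective _ (Submodule.ker_subtype _)
  choose g hg using h
  have hc : PiTensorProduct.map g ∘ₗ tensorIncl E = LinearMap.id := by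
    rw [tensorIncl, ← PiTensorProduct.map_comp]
    simp only [hg]
    exact PiTensorProduct.map_id
  intro a b hab
  have := congrArg (PiTensorProduct.map g) hab
  rwa [← LinearMap.comp_apply, ← LinearMap.comp_apply, hc] at this

theorem tensorForm_tensorIncl (E : ∀ i, FinSub 𝕜 (X i)) (f : ∀ i, StrongDual 𝕜 (E i).1)
    (g : ∀ i, StrongDual 𝕜 (X i)) (h : ∀ i, ∀ x : (E i).1, g i x = f i x)
    (u : ⨂[𝕜] i, (E i).1) :
    tensorForm 𝕜 X g (tensorIncl E u) = tensorForm 𝕜 (fun i => (E i).1) f u := by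
  have : tensorForm 𝕜 X g ∘ₗ tensorIncl E = tensorForm 𝕜 (fun i => (E i).1) f := by
    apply PiTensorProduct.ext
    ext x
    simp [tensorForm, tensorIncl, h]
  exact LinearMap.congr_fun this u

theorem projective_tensorIncl_le (E : ∀ i, FinSub 𝕜 (X i)) (u : ⨂[𝕜] i, (E i).1) :
    PiTensorProduct.projectiveSeminorm (tensorIncl E u) ≤
      PiTensorProduct.projectiveSeminorm u := by
  let f : ∀ i, (E i).1 →L[𝕜] X i := fun i => (E i).1.subtypeL
  have h : ∏ i, ‖f i‖ ≤ 1 :=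
    Finset.prod_le_one (fun i _ => norm_nonneg _) fun i _ => Submodule.norm_subtypeL_le _
  have k := (PiTensorProduct.mapL f).le_of_opNorm_le ((PiTensorProduct.opNorm_mapL f).trans h) u
  rw [one_mul] at k
  exact k

/-- The restriction `β|` of a reasonable crossnorm to `E₁ ⊗ ⋯ ⊗ Eₙ`. -/
def ReasonableCrossnorm.restrict (β : ReasonableCrossnorm 𝕜 X) (E : ∀ i, FinSub 𝕜 (X i)) :
    ReasonableCrossnorm 𝕜 (fun i => (E i).1) where
  toSeminorm := β.toSeminorm.comp (tensorIncl E)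
  eq_zero u hu := tensorIncl_injective E <| by
    rw [map_zero]; exact β.eq_zero _ hu
  injective_le f hf u := by
    choose g hg hgn using fun i => exists_extension_norm_eq (E i).1 (f i)
    rw [← tensorForm_tensorIncl E f g hg u]
    exact β.injective_le g (fun i => (hgn i).le.trans (hf i)) _
  le_projective u := (β.le_projective _).trans (projective_tensorIncl_le E u)

/-- The inclusion `(E₁ ⊗ ⋯ ⊗ Eₙ, β|) → (X₁ ⊗ ⋯ ⊗ Xₙ, β)`. -/
def crossIncl (β : ReasonableCrossnorm 𝕜 X) (E : ∀ i, FinSub 𝕜 (X i)) :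
    CrossTensor (β.restrict E) →ₗ[𝕜] CrossTensor β :=
  tensorIncl E

/-- The inclusion `E₁ ⊗ ⋯ ⊗ Eₙ ⊗ F → X₁ ⊗ ⋯ ⊗ Xₙ ⊗ Y`. -/
def incl (β : ReasonableCrossnorm 𝕜 X) {Y : Type u} [NormedAddCommGroup Y] [NormedSpace 𝕜 Y]
    (E : ∀ i, FinSub 𝕜 (X i)) (F : FinSub 𝕜 Y) :
    CrossTensor (β.restrict E) ⊗[𝕜] F.1 →ₗ[𝕜] CrossTensor β ⊗[𝕜] Y :=
  TensorProduct.map (crossIncl β E) F.1.subtype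

/-- The operator `Q_L T (I_{E₁} × ⋯ × I_{Eₙ}) : E₁ × ⋯ × Eₙ → Y / L`. -/
def localOperator {Y : Type u} [NormedAddCommGroup Y] [NormedSpace 𝕜 Y]
    (T : ContinuousMultilinearMap 𝕜 X Y) (E : ∀ i, FinSub 𝕜 (X i)) (L : CofinSub 𝕜 Y) :
    ContinuousMultilinearMap 𝕜 (fun i => (E i).1) (Y ⧸ L.1) :=
  L.1.mkQL.compContinuousMultilinearMap
    (T.compContinuousLinearMap fun i => (E i).1.subtypeL)

end Local

/-! ### `Σ`-ideals and `Σ`-tensor norms on duals -/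

/-- A `Σ`-ideal of multilinear operators on the class of Banach spaces. -/
structure SigmaIdeal (𝕜 : Type) [RCLike 𝕜] where
  /-- the component `𝒜^β(X₁, …, Xₙ; Y)` -/
  component : ∀ {n : ℕ} [NeZero n] {X : Fin n → Type u} [∀ i, NormedAddCommGroup (X i)]
    [∀ i, NormedSpace 𝕜 (X i)] [∀ i, CompleteSpace (X i)] (_β : ReasonableCrossnorm 𝕜 X)
    (Y : Type u) [NormedAddCommGroup Y] [NormedSpace 𝕜 Y] [CompleteSpace Y],
    Submodule 𝕜 (ContinuousMultilinearMap 𝕜 X Y)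
  /-- the norm `A^β` -/
  idealNorm : ∀ {n : ℕ} [NeZero n] {X : Fin n → Type u} [∀ i, NormedAddCommGroup (X i)]
    [∀ i, NormedSpace 𝕜 (X i)] [∀ i, CompleteSpace (X i)] (β : ReasonableCrossnorm 𝕜 X)
    (Y : Type u) [NormedAddCommGroup Y] [NormedSpace 𝕜 Y] [CompleteSpace Y],
    Seminorm 𝕜 (component β Y)
  eq_zero : ∀ {n : ℕ} [NeZero n] {X : Fin n → Type u} [∀ i, NormedAddCommGroup (X i)]
    [∀ i, NormedSpace 𝕜 (X i)] [∀ i, CompleteSpace (X i)] (β : ReasonableCrossnorm 𝕜 X)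
    (Y : Type u) [NormedAddCommGroup Y] [NormedSpace 𝕜 Y] [CompleteSpace Y]
    (T : component β Y), idealNorm β Y T = 0 → T = 0
  complete : ∀ {n : ℕ} [NeZero n] {X : Fin n → Type u} [∀ i, NormedAddCommGroup (X i)]
    [∀ i, NormedSpace 𝕜 (X i)] [∀ i, CompleteSpace (X i)] (β : ReasonableCrossnorm 𝕜 X)
    (Y : Type u) [NormedAddCommGroup Y] [NormedSpace 𝕜 Y] [CompleteSpace Y]
    (s : ℕ → component β Y),
    (∀ ε > 0, ∃ N, ∀ j ≥ N, ∀ k ≥ N, idealNorm β Y (s j - s k) < ε) →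
    ∃ T : component β Y, ∀ ε > 0, ∃ N, ∀ k ≥ N, idealNorm β Y (s k - T) < ε
  /-- rank-one operators -/
  rankOne_mem : ∀ {n : ℕ} [NeZero n] {X : Fin n → Type u} [∀ i, NormedAddCommGroup (X i)]
    [∀ i, NormedSpace 𝕜 (X i)] [∀ i, CompleteSpace (X i)] (β : ReasonableCrossnorm 𝕜 X)
    (Y : Type u) [NormedAddCommGroup Y] [NormedSpace 𝕜 Y] [CompleteSpace Y]
    (φ : Forms β) (y : Y),
    ∃ h : rankOne β φ y ∈ component β Y, idealNorm β Y ⟨rankOne β φ y, h⟩ ≤ ‖φ‖ * ‖y‖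
  /-- `Lip^β(f_T) ≤ A^β(T)` -/
  lip_le : ∀ {n : ℕ} [NeZero n] {X : Fin n → Type u} [∀ i, NormedAddCommGroup (X i)]
    [∀ i, NormedSpace 𝕜 (X i)] [∀ i, CompleteSpace (X i)] (β : ReasonableCrossnorm 𝕜 X)
    (Y : Type u) [NormedAddCommGroup Y] [NormedSpace 𝕜 Y] [CompleteSpace Y]
    (T : component β Y), ∀ p ∈ segre β, ∀ q ∈ segre β,
    ‖linearization β T.1 p - linearization β T.1 q‖ ≤ idealNorm β Y T * ‖p - q‖
  /-- the ideal property: `S f_T R ∈ 𝒜^θ` with `A^θ(S f_T R) ≤ ‖R‖ A^β(T) ‖S‖` -/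
  comp_mem : ∀ {n : ℕ} [NeZero n] {X : Fin n → Type u} [∀ i, NormedAddCommGroup (X i)]
    [∀ i, NormedSpace 𝕜 (X i)] [∀ i, CompleteSpace (X i)] (β : ReasonableCrossnorm 𝕜 X)
    (Y : Type u) [NormedAddCommGroup Y] [NormedSpace 𝕜 Y] [CompleteSpace Y]
    {m : ℕ} [NeZero m] {Z : Fin m → Type u} [∀ i, NormedAddCommGroup (Z i)]
    [∀ i, NormedSpace 𝕜 (Z i)] [∀ i, CompleteSpace (Z i)] (θ : ReasonableCrossnorm 𝕜 Z)
    (W : Type u) [NormedAddCommGroup W] [NormedSpace 𝕜 W] [CompleteSpace W]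
    (R : CrossTensor θ →L[𝕜] CrossTensor β) (_ : IsSigmaOperator R)
    (T : component β Y) (S : Y →L[𝕜] W),
    ∃ U : component θ W, (∀ z, U.1 z = S (linearization β T.1 (R (tensor θ z)))) ∧
      idealNorm θ W U ≤ ‖R‖ * idealNorm β Y T * ‖S‖

/-- A `Σ`-tensor norm on duals on the class of Banach spaces. -/
structure SigmaTensorNormOnDuals (𝕜 : Type) [RCLike 𝕜] where
  /-- the norm `ν_β` on `ℒ^β(X₁, …, Xₙ) ⊗ Y` -/
  norm : ∀ {n : ℕ} [NeZero n] {X : Fin n → Type u} [∀ i, NormedAddCommGroup (X i)]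
    [∀ i, NormedSpace 𝕜 (X i)] [∀ i, CompleteSpace (X i)] (β : ReasonableCrossnorm 𝕜 X)
    (Y : Type u) [NormedAddCommGroup Y] [NormedSpace 𝕜 Y] [CompleteSpace Y],
    Seminorm 𝕜 (Forms β ⊗[𝕜] Y)
  eq_zero : ∀ {n : ℕ} [NeZero n] {X : Fin n → Type u} [∀ i, NormedAddCommGroup (X i)]
    [∀ i, NormedSpace 𝕜 (X i)] [∀ i, CompleteSpace (X i)] (β : ReasonableCrossnorm 𝕜 X)
    (Y : Type u) [NormedAddCommGroup Y] [NormedSpace 𝕜 Y] [CompleteSpace Y]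
    (v : Forms β ⊗[𝕜] Y), norm β Y v = 0 → v = 0
  /-- `ν_β(φ ⊗ y) ≤ ‖φ‖_β ‖y‖` -/
  tmul_le : ∀ {n : ℕ} [NeZero n] {X : Fin n → Type u} [∀ i, NormedAddCommGroup (X i)]
    [∀ i, NormedSpace 𝕜 (X i)] [∀ i, CompleteSpace (X i)] (β : ReasonableCrossnorm 𝕜 X)
    (Y : Type u) [NormedAddCommGroup Y] [NormedSpace 𝕜 Y] [CompleteSpace Y]
    (φ : Forms β) (y : Y), norm β Y (φ ⊗ₜ[𝕜] y) ≤ ‖φ‖ * ‖y‖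
  /-- the functional `(p - q) ⊗ y*` is bounded with norm at most `β(p - q) ‖y*‖` -/
  evaluation_le : ∀ {n : ℕ} [NeZero n] {X : Fin n → Type u} [∀ i, NormedAddCommGroup (X i)]
    [∀ i, NormedSpace 𝕜 (X i)] [∀ i, CompleteSpace (X i)] (β : ReasonableCrossnorm 𝕜 X)
    (Y : Type u) [NormedAddCommGroup Y] [NormedSpace 𝕜 Y] [CompleteSpace Y],
    ∀ p ∈ segre β, ∀ q ∈ segre β, ∀ (g : StrongDual 𝕜 Y) (v : Forms β ⊗[𝕜] Y),
    ‖evaluationAt (p - q) g v‖ ≤ ‖p - q‖ * ‖g‖ * norm β Y v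
  /-- the uniform property: `‖A ⊗ B‖ ≤ ‖A‖ ‖B‖` whenever `A` preserves `Σ` -/
  map_le : ∀ {n : ℕ} [NeZero n] {X : Fin n → Type u} [∀ i, NormedAddCommGroup (X i)]
    [∀ i, NormedSpace 𝕜 (X i)] [∀ i, CompleteSpace (X i)] (β : ReasonableCrossnorm 𝕜 X)
    (Y : Type u) [NormedAddCommGroup Y] [NormedSpace 𝕜 Y] [CompleteSpace Y]
    {m : ℕ} [NeZero m] {Z : Fin m → Type u} [∀ i, NormedAddCommGroup (Z i)]
    [∀ i, NormedSpace 𝕜 (Z i)] [∀ i, CompleteSpace (Z i)] (θ : ReasonableCrossnorm 𝕜 Z)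
    (W : Type u) [NormedAddCommGroup W] [NormedSpace 𝕜 W] [CompleteSpace W]
    (A : Forms β →L[𝕜] Forms θ) (_ : PreservesSigma A) (B : Y →L[𝕜] W)
    (v : Forms β ⊗[𝕜] Y),
    norm θ W (TensorProduct.map (A : Forms β →ₗ[𝕜] Forms θ) (B : Y →ₗ[𝕜] W) v) ≤
      ‖A‖ * ‖B‖ * norm β Y v

section

variable {𝕜 : Type} [RCLike 𝕜] {n : ℕ} [NeZero n] {X : Fin n → Type u}
  [∀ i, NormedAddCommGroup (X i)] [∀ i, NormedSpace 𝕜 (X i)] [∀ i, CompleteSpace (X i)]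

open Classical in
/-- The ideal norm, extended by `∞` to all bounded multilinear operators outside the component. -/
def SigmaIdeal.extNorm (A : SigmaIdeal.{u} 𝕜) (β : ReasonableCrossnorm 𝕜 X) {Y : Type u}
    [NormedAddCommGroup Y] [NormedSpace 𝕜 Y] [CompleteSpace Y]
    (T : ContinuousMultilinearMap 𝕜 X Y) : ℝ≥0∞ :=
  if h : T ∈ A.component β Y then ENNReal.ofReal (A.idealNorm β Y ⟨T, h⟩) else ∞

end

/-- A `Σ`-ideal is maximal if it coincides with its maximal hull: for every bounded multilinear
operator `T`, `T` is in the component exactly when the supremum of the ideal norms of the operators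
`Q_L T (I_{E₁} × ⋯ × I_{Eₙ})` is finite, and the ideal norm of `T` is then this supremum. -/
def SigmaIdeal.IsMaximal {𝕜 : Type} [RCLike 𝕜] (A : SigmaIdeal.{u} 𝕜) : Prop :=
  ∀ {n : ℕ} [NeZero n] {X : Fin n → Type u} [∀ i, NormedAddCommGroup (X i)]
    [∀ i, NormedSpace 𝕜 (X i)] [∀ i, CompleteSpace (X i)] (β : ReasonableCrossnorm 𝕜 X)
    (Y : Type u) [NormedAddCommGroup Y] [NormedSpace 𝕜 Y] [CompleteSpace Y]
    (T : ContinuousMultilinearMap 𝕜 X Y),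
    A.extNorm β T = ⨆ (E : ∀ i, FinSub 𝕜 (X i)) (L : CofinSub 𝕜 Y),
      A.extNorm (β.restrict E) (localOperator T E L)

/-- `𝒜` and `ν` are associated: for finite dimensional spaces the map `φ ⊗ y ↦ φ · y` is an
isometric isomorphism of `(ℒ^β(E₁, …, Eₙ) ⊗ F, ν_β)` onto `𝒜^β(E₁, …, Eₙ; F)`. -/
def SigmaIdeal.IsAssociated {𝕜 : Type} [RCLike 𝕜] (A : SigmaIdeal.{u} 𝕜)
    (ν : SigmaTensorNormOnDuals.{u} 𝕜) : Prop :=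
  ∀ {n : ℕ} [NeZero n] {E : Fin n → Type u} [∀ i, NormedAddCommGroup (E i)]
    [∀ i, NormedSpace 𝕜 (E i)] [∀ i, CompleteSpace (E i)] [∀ i, FiniteDimensional 𝕜 (E i)]
    (β : ReasonableCrossnorm 𝕜 E)
    (F : Type u) [NormedAddCommGroup F] [NormedSpace 𝕜 F] [CompleteSpace F]
    [FiniteDimensional 𝕜 F],
    ∃ Φ : (Forms β ⊗[𝕜] F) ≃ₗ[𝕜] A.component β F,
      ∀ v, (Φ v : ContinuousMultilinearMap 𝕜 E F) = toOperator β F v ∧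
        A.idealNorm β F (Φ v) = ν.norm β F v

/-! ### Duals -/

section Dual

variable {𝕜 : Type} [RCLike 𝕜] {V : Type u} [AddCommGroup V] [Module 𝕜 V]

/-- The topological dual of `(V, N)`: the linear functionals that are bounded with respect to
`N`. -/
def boundedDual (N : V → ℝ) : Submodule 𝕜 (Module.Dual 𝕜 V) where
  carrier := {φ | ∃ C : ℝ, 0 ≤ C ∧ ∀ u, ‖φ u‖ ≤ C * N u}
  zero_mem' := ⟨0, le_rfl, fun u => by simp⟩
  add_mem' := by
    rintro φ ψ ⟨C, hC, h⟩ ⟨D, hD, k⟩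
    refine ⟨C + D, add_nonneg hC hD, fun u => ?_⟩
    rw [add_mul]
    exact (norm_add_le _ _).trans (add_le_add (h u) (k u))
  smul_mem' := by
    rintro c φ ⟨C, hC, h⟩
    refine ⟨‖c‖ * C, by positivity, fun u => ?_⟩
    rw [LinearMap.smul_apply, norm_smul, mul_assoc]
    exact mul_le_mul_of_nonneg_left (h u) (norm_nonneg c)

/-- The norm of a functional on `(V, N)`. -/
def dualNorm (N : V → ℝ) (φ : Module.Dual 𝕜 V) : ℝ :=
  sInf {C : ℝ | 0 ≤ C ∧ ∀ u, ‖φ u‖ ≤ C * N u}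

end Dual

section

variable {𝕜 : Type} [RCLike 𝕜] {n : ℕ} [NeZero n] {X : Fin n → Type u}
  [∀ i, NormedAddCommGroup (X i)] [∀ i, NormedSpace 𝕜 (X i)] [∀ i, CompleteSpace (X i)]

/-- The norm on `E₁ ⊗ ⋯ ⊗ Eₙ ⊗ F` (for finite dimensional spaces) for which it is the dual
`(ℒ^β(E₁, …, Eₙ) ⊗ F*, ν_β)*`, tensors acting by evaluation. -/
def SigmaTensorNormOnDuals.finDual (ν : SigmaTensorNormOnDuals.{u} 𝕜)
    (β : ReasonableCrossnorm 𝕜 X) (F : Type u) [NormedAddCommGroup F] [NormedSpace 𝕜 F]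
    [CompleteSpace F] (u : CrossTensor β ⊗[𝕜] F) : ℝ :=
  dualNorm (ν.norm β (StrongDual 𝕜 F)) ((evaluation β F).flip u)

/-- The finitely generated `Σ`-tensor norm on spaces `α` defined by `ν`: `α^β(u)` is the infimum
of the norms of `u` in `E₁ ⊗ ⋯ ⊗ Eₙ ⊗ F = (ℒ^{β|}(E₁, …, Eₙ) ⊗ F*, ν_{β|})*` over all finite
dimensional subspaces with `u ∈ E₁ ⊗ ⋯ ⊗ Eₙ ⊗ F`. -/
def SigmaTensorNormOnDuals.onSpaces (ν : SigmaTensorNormOnDuals.{u} 𝕜)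
    (β : ReasonableCrossnorm 𝕜 X) (Y : Type u) [NormedAddCommGroup Y] [NormedSpace 𝕜 Y]
    [CompleteSpace Y] (u : CrossTensor β ⊗[𝕜] Y) : ℝ :=
  sInf {r : ℝ | ∃ (E : ∀ i, FinSub 𝕜 (X i)) (F : FinSub 𝕜 Y)
    (w : CrossTensor (β.restrict E) ⊗[𝕜] F.1),
    incl β E F w = u ∧ r = ν.finDual (β.restrict E) F.1 w}

/-- `(X₁ ⊗ ⋯ ⊗ Xₙ ⊗ Y*, N)* ∩ ℒ(X₁, …, Xₙ; Y)`: the bounded functionals `φ` of the form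
`φ(x₁ ⊗ ⋯ ⊗ xₙ ⊗ y*) = y*(T(x₁, …, xₙ))` with a bounded multilinear operator
`T : X₁ × ⋯ × Xₙ → Y`. -/
def dualInterOperators (β : ReasonableCrossnorm 𝕜 X) (Y : Type u) [NormedAddCommGroup Y]
    [NormedSpace 𝕜 Y] (N : CrossTensor β ⊗[𝕜] StrongDual 𝕜 Y → ℝ) :
    Submodule 𝕜 (Module.Dual 𝕜 (CrossTensor β ⊗[𝕜] StrongDual 𝕜 Y)) where
  carrier := {φ | φ ∈ boundedDual (𝕜 := 𝕜) N ∧ ∃ T : ContinuousMultilinearMap 𝕜 X Y,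
    ∀ x g, φ (tensor β x ⊗ₜ[𝕜] g) = g (T x)}
  zero_mem' := ⟨Submodule.zero_mem _, 0, fun x g => by simp⟩
  add_mem' := by
    rintro φ ψ ⟨h, T, hT⟩ ⟨k, S, hS⟩
    exact ⟨Submodule.add_mem _ h k, T + S, fun x g => by simp [hT, hS]⟩
  smul_mem' := by
    rintro c φ ⟨h, T, hT⟩
    exact ⟨Submodule.smul_mem _ c h, c • T, fun x g => by simp [hT]⟩

end

end SigmaIdeals

end

open SigmaIdeals

/-!
For finite dimensional spaces, association and biduality give `𝒜^β(E₁, …, Eₙ; F*) =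
(E₁ ⊗ ⋯ ⊗ Eₙ ⊗ F, α^β)*` isometrically, and a functional on `X₁ ⊗ ⋯ ⊗ Xₙ ⊗ Y` is `α`-bounded by
`C` exactly when all its restrictions to `E₁ ⊗ ⋯ ⊗ Eₙ ⊗ F` are. The closed finite codimensional
subspaces `L` of `Y` are the pre-annihilators of the finite dimensional subspaces `F` of `Y*`, and
`Y / L = F*` isometrically. Hence maximality says that `A^β(T) ≤ C` exactly when the functional of
`T` on `X₁ ⊗ ⋯ ⊗ Xₙ ⊗ Y*` is `α`-bounded by `C`, which is the second representation. Applied to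
an operator into `Y*` it involves functionals on `X₁ ⊗ ⋯ ⊗ Xₙ ⊗ Y**`; local reflexivity of `Y`
replaces `Y**` by `Y` without changing the bounds, which is the first representation.
-/

noncomputable section

namespace SigmaIdeals

theorem exists_linearEquiv_of_map_eq {R M N : Type*} [Semiring R] [AddCommMonoid M]
    [Module R M] [AddCommMonoid N] [Module R N] {f : M →ₗ[R] N} (hf : Function.Injective f)
    {p : Submodule R M} {q : Submodule R N} (hpq : p.map f = q) :
    ∃ e : q ≃ₗ[R] p, ∀ y, f (e y) = y := by
  subst hpq
  exact ⟨(p.equivMapOfInjective f hf).symm, fun y =>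
    congrArg Subtype.val ((p.equivMapOfInjective f hf).apply_symm_apply y)⟩

/-! ### Hahn–Banach and local reflexivity -/

section HahnBanach

variable {𝕜 V W : Type*} [RCLike 𝕜] [AddCommGroup V] [Module 𝕜 V] [AddCommGroup W] [Module 𝕜 W]

theorem exists_dual_comp_eq_of_le_seminorm (Θ : V →ₗ[𝕜] W) (p : Seminorm 𝕜 W)
    (φ : Module.Dual 𝕜 V) (hφ : ∀ v, ‖φ v‖ ≤ p (Θ v)) :
    ∃ ψ : Module.Dual 𝕜 W, ψ ∘ₗ Θ = φ ∧ ∀ w, ‖ψ w‖ ≤ p w := by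
  obtain ⟨σ, hσ⟩ := Θ.rangeRestrict.exists_rightInverse_of_surjective Θ.range_rangeRestrict
  have hΘσ : ∀ w, Θ (σ w) = w := fun w => congrArg Subtype.val (LinearMap.congr_fun hσ w)
  obtain ⟨ψ, hψ, hle⟩ := Module.Dual.exists_extension_of_le_seminorm Θ.range (φ ∘ₗ σ)
    (p := p) fun w => (hφ _).trans_eq (congrArg p (hΘσ w))
  refine ⟨ψ, LinearMap.ext fun v => ?_, hle⟩
  have hzero : φ (σ (Θ.rangeRestrict v) - v) = 0 := by
    refine norm_le_zero_iff.1 ((hφ _).trans_eq ?_)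
    rw [map_sub, hΘσ, LinearMap.codRestrict_apply, sub_self, map_zero]
  rw [map_sub, sub_eq_zero] at hzero
  exact (hψ (Θ.rangeRestrict v)).trans hzero

theorem exists_dual_apply_eq_seminorm (p : Seminorm 𝕜 V) (v : V) :
    ∃ ψ : Module.Dual 𝕜 V, ψ v = (p v : 𝕜) ∧ ∀ w, ‖ψ w‖ ≤ p w := by
  obtain ⟨ψ, hψ, hle⟩ := exists_dual_comp_eq_of_le_seminorm (LinearMap.toSpanSingleton 𝕜 V v) p
    (LinearMap.toSpanSingleton 𝕜 𝕜 (p v : 𝕜)) fun c => by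
      rw [LinearMap.toSpanSingleton_apply, LinearMap.toSpanSingleton_apply, map_smul_eq_mul,
        norm_smul, RCLike.norm_ofReal, abs_of_nonneg (apply_nonneg p v)]
  refine ⟨ψ, ?_, hle⟩
  simpa only [LinearMap.comp_apply, LinearMap.toSpanSingleton_apply, one_smul] using
    LinearMap.congr_fun hψ 1

end HahnBanach

section DualForm

open NormedSpace (inclusionInDoubleDual)

variable {𝕜 V Y : Type*} [RCLike 𝕜] [AddCommGroup V] [Module 𝕜 V] [NormedAddCommGroup Y]
  [NormedSpace 𝕜 Y]

/-- The functional on `V ⊗ Y` of an operator `S : V → Y*`, `v ⊗ y ↦ S v y`. -/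
def dualForm : (V →ₗ[𝕜] StrongDual 𝕜 Y) →ₗ[𝕜] Module.Dual 𝕜 (V ⊗[𝕜] Y) :=
  (TensorProduct.lift.equiv (RingHom.id 𝕜) V Y 𝕜).toLinearMap ∘ₗ
    LinearMap.compRight 𝕜 (ContinuousLinearMap.coeLM 𝕜)

theorem dualForm_tmul (S : V →ₗ[𝕜] StrongDual 𝕜 Y) (v : V) (y : Y) :
    dualForm S (v ⊗ₜ y) = S v y := rfl

/-- The functional on `V ⊗ Y*` of an operator `R : V → Y`, `v ⊗ y* ↦ y* (R v)`. -/
def operatorForm : (V →ₗ[𝕜] Y) →ₗ[𝕜] Module.Dual 𝕜 (V ⊗[𝕜] StrongDual 𝕜 Y) :=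
  dualForm ∘ₗ LinearMap.compRight 𝕜 (inclusionInDoubleDual 𝕜 Y).toLinearMap

theorem operatorForm_tmul (R : V →ₗ[𝕜] Y) (v : V) (g : StrongDual 𝕜 Y) :
    operatorForm R (v ⊗ₜ g) = g (R v) := rfl

end DualForm

section LocalReflexivity

variable {𝕜 : Type*} [RCLike 𝕜]

theorem exists_finset_mul_opNorm_le (F Y : Type*) [NormedAddCommGroup F] [NormedSpace 𝕜 F]
    [FiniteDimensional 𝕜 F] [NormedAddCommGroup Y] [NormedSpace 𝕜 Y] {r : ℝ} (hr : r < 1) :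
    ∃ s : Finset F, (∀ f ∈ s, ‖f‖ ≤ 1) ∧
      ∀ R : F →L[𝕜] Y, r * ‖R‖ ≤ ‖fun f : s => R f‖ := by
  have := FiniteDimensional.proper 𝕜 F
  obtain ⟨t, ht_le, ht, hcover⟩ :=
    (isCompact_closedBall (0 : F) 1).finite_cover_balls (sub_pos.2 hr)
  refine ⟨ht.toFinset, fun f hf => by simpa using ht_le (ht.mem_toFinset.1 hf), fun R => ?_⟩
  set c := ‖fun f : ht.toFinset => R f‖
  let : NormedSpace ℝ F := NormedSpace.restrictScalars ℝ 𝕜 F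
  suffices ‖R‖ ≤ c + ‖R‖ * (1 - r) by linarith
  have hc : 0 ≤ c := norm_nonneg _
  refine R.opNorm_le_of_unit_norm
    (add_nonneg hc (mul_nonneg (norm_nonneg R) (sub_nonneg.2 hr.le))) fun x hx => ?_
  obtain ⟨f, hf, hxf⟩ :=
    Set.mem_iUnion₂.1 (hcover (show x ∈ Metric.closedBall 0 1 by simp [hx]))
  calc ‖R x‖ = ‖R f + R (x - f)‖ := by rw [← map_add, add_sub_cancel]
    _ ≤ ‖R f‖ + ‖R (x - f)‖ := norm_add_le _ _
    _ ≤ c + ‖R‖ * (1 - r) := add_le_add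
      (norm_le_pi_norm (fun f : ht.toFinset => R f) ⟨f, ht.mem_toFinset.2 hf⟩)
      (R.le_opNorm_of_le (mem_ball_iff_norm.1 hxf).le)

theorem exists_norm_le_one_mul_norm_le_apply {Y : Type*} [NormedAddCommGroup Y] [NormedSpace 𝕜 Y]
    (g : StrongDual 𝕜 Y) {r : ℝ} (hr : r < 1) :
    ∃ y : Y, ‖y‖ ≤ 1 ∧ ∃ a : ℝ, r * ‖g‖ ≤ a ∧ g y = (a : 𝕜) := by
  rcases (norm_nonneg g).eq_or_lt with hg | hg
  · exact ⟨0, by simp, 0, by simp [← hg], by simp⟩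
  obtain ⟨y, hy, hlt⟩ := g.exists_lt_apply_of_lt_opNorm (mul_lt_of_lt_one_left hg hr)
  obtain ⟨c, hc, hcy⟩ := RCLike.exists_norm_eq_mul_self (g y)
  exact ⟨c • y, by rw [norm_smul, hc, one_mul]; exact hy.le, ‖g y‖, hlt.le, by
    rw [map_smul, smul_eq_mul, hcy]⟩

theorem sum_norm_comp_single_le {ι Y : Type*} [Fintype ι] [DecidableEq ι] [NormedAddCommGroup Y]
    [NormedSpace 𝕜 Y] (h : StrongDual 𝕜 (ι → Y)) :
    ∑ j, ‖h ∘SL ContinuousLinearMap.single 𝕜 (fun _ : ι => Y) j‖ ≤ ‖h‖ := by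
  set g := fun j => h ∘SL ContinuousLinearMap.single 𝕜 (fun _ : ι => Y) j
  rw [← one_mul (∑ j, _)]
  refine mul_le_of_forall_lt_of_nonneg zero_le_one (norm_nonneg h) fun r hr0 hr b _ hb => ?_
  choose y hy a ha hga using fun j => exists_norm_le_one_mul_norm_le_apply (g j) hr
  have hhy : h y = ((∑ j, a j : ℝ) : 𝕜) := by
    conv_lhs => rw [← Finset.univ_sum_single y]
    rw [map_sum, RCLike.ofReal_sum]
    exact Finset.sum_congr rfl fun j _ => hga j
  calc r * b ≤ r * ∑ j, ‖g j‖ := by gcongr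
    _ ≤ ∑ j, a j := by rw [Finset.mul_sum]; exact Finset.sum_le_sum fun j _ => ha j
    _ ≤ ‖h y‖ := by rw [hhy, RCLike.norm_ofReal]; exact le_abs_self _
    _ ≤ ‖h‖ := h.unit_le_opNorm y ((pi_norm_le_iff_of_nonneg zero_le_one).2 hy)

variable {F Y : Type*} [NormedAddCommGroup F] [NormedSpace 𝕜 F] [FiniteDimensional 𝕜 F]
  [NormedAddCommGroup Y] [NormedSpace 𝕜 Y]

theorem eq_of_forall_operatorForm_eq {t t' : F ⊗[𝕜] StrongDual 𝕜 Y}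
    (h : ∀ R : F →ₗ[𝕜] Y, operatorForm R t = operatorForm R t') : t = t' := by
  let b := Module.finBasis 𝕜 F
  have hcoord : ∀ (t : F ⊗[𝕜] StrongDual 𝕜 Y) k y,
      TensorProduct.equivFinsuppOfBasisLeft b t k y =
        operatorForm ((b.coord k).smulRight y) t := fun t k y => by
    induction t with
    | zero => simp
    | add t t' ht ht' => simp only [map_add, Finsupp.add_apply, add_apply, ht, ht']
    | tmul f g => simp [operatorForm_tmul]
  refine (TensorProduct.equivFinsuppOfBasisLeft b).injective (Finsupp.ext fun k => ?_)
  ext y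
  rw [hcoord, hcoord, h]

/-- Embed `ℒ(F, Y)` almost isometrically into a finite `ℓ∞`-sum of copies of `Y` and extend the
functional given by `t` to that sum. -/
theorem exists_eq_sum_tmul_of_norm_operatorForm_le {t : F ⊗[𝕜] StrongDual 𝕜 Y} {C r : ℝ}
    (hC : 0 ≤ C) (hr0 : 0 < r) (hr : r < 1)
    (h : ∀ R : F →L[𝕜] Y, ‖operatorForm R.toLinearMap t‖ ≤ C * ‖R‖) :
    ∃ (s : Finset F) (g : s → StrongDual 𝕜 Y), (∀ f ∈ s, ‖f‖ ≤ 1) ∧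
      t = ∑ f : s, f.1 ⊗ₜ g f ∧ ∑ f, ‖g f‖ ≤ C / r := by
  classical
  obtain ⟨s, hs, hnorming⟩ := exists_finset_mul_opNorm_le (𝕜 := 𝕜) F Y hr
  let Θ : (F →ₗ[𝕜] Y) →ₗ[𝕜] (s → Y) := LinearMap.pi fun f => LinearMap.applyₗ f.1
  let p : Seminorm 𝕜 (s → Y) := (C / r).toNNReal • normSeminorm 𝕜 (s → Y)
  have hp : ∀ y, p y = C / r * ‖y‖ := fun y =>
    congrArg (· * ‖y‖) (Real.coe_toNNReal _ (div_nonneg hC hr0.le))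
  obtain ⟨φ, hφΘ, hφ⟩ := exists_dual_comp_eq_of_le_seminorm Θ p (operatorForm.flip t) fun R => by
    rw [hp, div_mul_eq_mul_div, mul_div_assoc]
    refine (h R.toContinuousLinearMap).trans (mul_le_mul_of_nonneg_left ?_ hC)
    exact (le_div_iff₀' hr0).2 (hnorming R.toContinuousLinearMap)
  let ψ : StrongDual 𝕜 (s → Y) := φ.mkContinuous (C / r) fun y => (hφ y).trans_eq (hp y)
  refine ⟨s, fun f => ψ ∘SL ContinuousLinearMap.single 𝕜 (fun _ : s => Y) f, hs,
    eq_of_forall_operatorForm_eq fun R => ?_,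
    (sum_norm_comp_single_le ψ).trans (φ.mkContinuous_norm_le (by positivity) _)⟩
  calc operatorForm R t = ψ (Θ R) := (LinearMap.congr_fun hφΘ R).symm
    _ = ψ (∑ f : s, Pi.single f (R f.1)) := by rw [Finset.univ_sum_single fun f : s => R f.1]; rfl
    _ = _ := by rw [map_sum, map_sum]; rfl

/-- Local reflexivity, in the form `ℒ(F, Y)** = ℒ(F, Y**)` for finite dimensional `F`. -/
theorem norm_dualForm_le_of_norm_operatorForm_le {t : F ⊗[𝕜] StrongDual 𝕜 Y} {C : ℝ}
    (hC : 0 ≤ C) (h : ∀ R : F →L[𝕜] Y, ‖operatorForm R.toLinearMap t‖ ≤ C * ‖R‖)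
    (S : F →ₗ[𝕜] StrongDual 𝕜 (StrongDual 𝕜 Y)) (hS : ∀ f, ‖S f‖ ≤ ‖f‖) :
    ‖dualForm S t‖ ≤ C := by
  rw [← one_mul ‖dualForm S t‖]
  refine mul_le_of_forall_lt_of_nonneg zero_le_one hC fun r hr0 hr b _ hb => ?_
  obtain rfl | hr0 := hr0.eq_or_lt
  · rwa [zero_mul]
  obtain ⟨s, g, hs, rfl, hg⟩ := exists_eq_sum_tmul_of_norm_operatorForm_le hC hr0 hr h
  have hsum : ‖dualForm S (∑ f : s, f.1 ⊗ₜ g f)‖ ≤ ∑ f, ‖g f‖ := by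
    rw [map_sum]
    refine (norm_sum_le _ _).trans (Finset.sum_le_sum fun f _ => ?_)
    simpa only [dualForm_tmul, one_mul] using
      (S f.1).le_of_opNorm_le ((hS f).trans (hs f f.2)) (g f)
  exact (le_div_iff₀' hr0).1 (hb.le.trans (hsum.trans hg))

theorem norm_operatorForm_map_le_of_norm_dualForm_map_le {V : Type*} [AddCommGroup V]
    [Module 𝕜 V] (L : V →ₗ[𝕜] StrongDual 𝕜 Y) {w : V ⊗[𝕜] F} {C : ℝ} (hC : 0 ≤ C)
    (h : ∀ R : F →L[𝕜] Y, ‖dualForm L (TensorProduct.map .id R.toLinearMap w)‖ ≤ C * ‖R‖)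
    (S : F →ₗ[𝕜] StrongDual 𝕜 (StrongDual 𝕜 Y)) (hS : ∀ f, ‖S f‖ ≤ ‖f‖) :
    ‖operatorForm L (TensorProduct.map .id S w)‖ ≤ C := by
  let τ : V ⊗[𝕜] F →ₗ[𝕜] F ⊗[𝕜] StrongDual 𝕜 Y :=
    (TensorProduct.comm 𝕜 (StrongDual 𝕜 Y) F).toLinearMap ∘ₗ TensorProduct.map L .id
  have hdual : operatorForm L ∘ₗ TensorProduct.map .id S = dualForm S ∘ₗ τ :=
    TensorProduct.ext' fun v f => rfl
  have hop (R : F →L[𝕜] Y) : operatorForm R.toLinearMap ∘ₗ τ =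
      dualForm L ∘ₗ TensorProduct.map .id R.toLinearMap := TensorProduct.ext' fun v f => rfl
  rw [← LinearMap.comp_apply, hdual]
  refine norm_dualForm_le_of_norm_operatorForm_le hC (fun R => ?_) S hS
  rw [← LinearMap.comp_apply, hop]
  exact h R

end LocalReflexivity

/-! ### Dual norms -/

section DualNorm

variable {𝕜 : Type} [RCLike 𝕜] {V : Type u} [AddCommGroup V] [Module 𝕜 V] {N : V → ℝ}
  {φ : Module.Dual 𝕜 V}

theorem dualNorm_nonneg (N : V → ℝ) (φ : Module.Dual 𝕜 V) : 0 ≤ dualNorm N φ :=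
  Real.sInf_nonneg fun _ h => h.1

theorem dualNorm_le {C : ℝ} (hC : 0 ≤ C) (h : ∀ u, ‖φ u‖ ≤ C * N u) : dualNorm N φ ≤ C :=
  csInf_le ⟨0, fun _ h => h.1⟩ ⟨hC, h⟩

theorem norm_le_dualNorm_mul (hN : ∀ u, 0 ≤ N u) (hφ : φ ∈ boundedDual (𝕜 := 𝕜) N) (u : V) :
    ‖φ u‖ ≤ dualNorm N φ * N u := by
  obtain ⟨C, hC⟩ := hφ
  rcases (hN u).eq_or_lt with hu | hu
  · simpa only [← hu, mul_zero] using hC.2 u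
  · exact (div_le_iff₀ hu).1 <| le_csInf ⟨C, hC⟩ fun D hD => (div_le_iff₀ hu).2 (hD.2 u)

theorem dualNorm_eq_of_forall_le_iff {a : ℝ} (ha : 0 ≤ a)
    (h : ∀ C, 0 ≤ C → ((∀ u, ‖φ u‖ ≤ C * N u) ↔ a ≤ C)) : dualNorm N φ = a := by
  have : {C : ℝ | 0 ≤ C ∧ ∀ u, ‖φ u‖ ≤ C * N u} = Set.Ici a :=
    Set.ext fun C => ⟨fun hC => (h C hC.1).1 hC.2, fun hC =>
      ⟨ha.trans hC, (h C (ha.trans hC)).2 hC⟩⟩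
  rw [dualNorm, this, csInf_Ici]

end DualNorm

/-! ### The tensor product `(X₁ ⊗ ⋯ ⊗ Xₙ, β)` -/

section CrossTensor

variable {𝕜 : Type} [RCLike 𝕜] {n : ℕ} {X : Fin n → Type u} [∀ i, NormedAddCommGroup (X i)]
  [∀ i, NormedSpace 𝕜 (X i)] (β : ReasonableCrossnorm 𝕜 X) {Y : Type u} [NormedAddCommGroup Y]
  [NormedSpace 𝕜 Y]

theorem norm_tensor_le (x : ∀ i, X i) : ‖tensor β x‖ ≤ ∏ i, ‖x i‖ :=
  (β.le_projective _).trans (PiTensorProduct.projectiveSeminorm_tprod_le x)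

theorem linearization_tensor (T : ContinuousMultilinearMap 𝕜 X Y) (x : ∀ i, X i) :
    linearization β T (tensor β x) = T x :=
  PiTensorProduct.lift.tprod (φ := T.toMultilinearMap) x

theorem crossIncl_tensor (E : ∀ i, FinSub 𝕜 (X i)) (x : ∀ i, (E i).1) :
    crossIncl β E (tensor (β.restrict E) x) = tensor β fun i => (x i : X i) :=
  PiTensorProduct.map_tprod _ x

theorem span_segre : Submodule.span 𝕜 (segre β) = ⊤ :=
  PiTensorProduct.span_tprod_eq_top (R := 𝕜) (s := X)

variable {β}

theorem crossTensor_ext {M : Type*} [AddCommGroup M] [Module 𝕜 M] {f g : CrossTensor β →ₗ[𝕜] M}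
    (h : ∀ x, f (tensor β x) = g (tensor β x)) : f = g :=
  LinearMap.ext_on (span_segre β) (Set.forall_mem_range.2 h)

variable (β)

theorem span_range_tensor_tmul (Y : Type*) [AddCommGroup Y] [Module 𝕜 Y] :
    Submodule.span 𝕜 (Set.range fun p : (∀ i, X i) × Y => tensor β p.1 ⊗ₜ[𝕜] p.2) = ⊤ := by
  have himage : (Set.range fun p : (∀ i, X i) × Y => tensor β p.1 ⊗ₜ[𝕜] p.2) =
      Set.image2 (fun w y => TensorProduct.mk 𝕜 (CrossTensor β) Y w y) (segre β) Set.univ := by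
    rw [segre, ← Set.range_id, Set.image2_range]; rfl
  rw [himage, ← Submodule.map₂_span_span, span_segre, Submodule.span_univ,
    TensorProduct.map₂_mk_top_top_eq_top]

instance [∀ i, FiniteDimensional 𝕜 (X i)] : FiniteDimensional 𝕜 (CrossTensor β) :=
  Module.Basis.finiteDimensional_of_finite
    (Basis.piTensorProduct fun i => Module.finBasis 𝕜 (X i))

theorem toOperator_surjective [∀ i, FiniteDimensional 𝕜 (X i)] [FiniteDimensional 𝕜 Y] :
    Function.Surjective (toOperator β Y) := by
  intro T
  let b := Module.finBasis 𝕜 Y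
  refine ⟨∑ k, LinearMap.toContinuousLinearMap (b.coord k ∘ₗ linearization β T) ⊗ₜ[𝕜] b k, ?_⟩
  ext x
  calc _ = ∑ k, b.repr (linearization β T (tensor β x)) k • b k := by
        rw [map_sum, sum_apply]; rfl
    _ = T x := by rw [b.sum_repr, linearization_tensor]

theorem evaluation_map {Z : Type u} [NormedAddCommGroup Z]
    [NormedSpace 𝕜 Z] (B : Y →L[𝕜] Z) (v : Forms β ⊗[𝕜] StrongDual 𝕜 Z)
    (w : CrossTensor β ⊗[𝕜] Y) :
    evaluation β Z v (TensorProduct.map LinearMap.id B.toLinearMap w) =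
      evaluation β Y (TensorProduct.map LinearMap.id
        ((ContinuousLinearMap.compL 𝕜 Y Z 𝕜).flip B).toLinearMap v) w := by
  induction v with
  | zero => simp only [map_zero, LinearMap.zero_apply]
  | add v v' h h' => simp only [map_add, LinearMap.add_apply, h, h']
  | tmul φ g =>
    induction w with
    | zero => simp only [map_zero]
    | add w w' h h' => simp only [map_add, h, h']
    | tmul w y => rfl

theorem evaluation_bijective [∀ i, FiniteDimensional 𝕜 (X i)] [FiniteDimensional 𝕜 Y] :
    Function.Bijective (evaluation β Y) :=
  (TensorProduct.congr LinearMap.toContinuousLinearMap.symm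
    LinearMap.toContinuousLinearMap.symm ≪≫ₗ
      TensorProduct.dualDistribEquiv 𝕜 (CrossTensor β) Y).bijective

theorem evaluation_flip_surjective [∀ i, FiniteDimensional 𝕜 (X i)] [FiniteDimensional 𝕜 Y] :
    Function.Surjective (evaluation β Y).flip :=
  (LinearMap.flip_surjective_iff₁ (K := 𝕜) (V₁ := Forms β ⊗[𝕜] StrongDual 𝕜 Y)).2
    (evaluation_bijective β).injective

/-- `linearization`, as a linear map. -/
def linearizationₗ (Y : Type u) [NormedAddCommGroup Y] [NormedSpace 𝕜 Y] :
    ContinuousMultilinearMap 𝕜 X Y →ₗ[𝕜] CrossTensor β →ₗ[𝕜] Y where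
  toFun := linearization β
  map_add' S T := crossTensor_ext fun x => by
    simp only [linearization_tensor, LinearMap.add_apply, add_apply]
  map_smul' c T := crossTensor_ext fun x => by
    simp only [linearization_tensor, LinearMap.smul_apply, smul_apply, RingHom.id_apply]

/-- The functional on `X₁ ⊗ ⋯ ⊗ Xₙ ⊗ Y` of a multilinear operator `T` into `Y*`,
`x₁ ⊗ ⋯ ⊗ xₙ ⊗ y ↦ T(x₁, …, xₙ)(y)`. -/
def multilinearDualForm :
    ContinuousMultilinearMap 𝕜 X (StrongDual 𝕜 Y) →ₗ[𝕜] Module.Dual 𝕜 (CrossTensor β ⊗[𝕜] Y) :=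
  dualForm ∘ₗ linearizationₗ β (StrongDual 𝕜 Y)

/-- The functional on `X₁ ⊗ ⋯ ⊗ Xₙ ⊗ Y*` of a multilinear operator `T` into `Y`,
`x₁ ⊗ ⋯ ⊗ xₙ ⊗ y* ↦ y*(T(x₁, …, xₙ))`. -/
def multilinearOperatorForm :
    ContinuousMultilinearMap 𝕜 X Y →ₗ[𝕜] Module.Dual 𝕜 (CrossTensor β ⊗[𝕜] StrongDual 𝕜 Y) :=
  operatorForm ∘ₗ linearizationₗ β Y

theorem multilinearDualForm_tensor_tmul (T : ContinuousMultilinearMap 𝕜 X (StrongDual 𝕜 Y))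
    (x : ∀ i, X i) (y : Y) : multilinearDualForm β T (tensor β x ⊗ₜ y) = T x y :=
  congrArg (fun g : StrongDual 𝕜 Y => g y) (linearization_tensor β T x)

theorem multilinearOperatorForm_tensor_tmul (T : ContinuousMultilinearMap 𝕜 X Y)
    (x : ∀ i, X i) (g : StrongDual 𝕜 Y) :
    multilinearOperatorForm β T (tensor β x ⊗ₜ g) = g (T x) :=
  congrArg g (linearization_tensor β T x)

theorem multilinearDualForm_injective :
    Function.Injective (multilinearDualForm (Y := Y) β) := by
  intro S T h
  ext x y
  rw [← multilinearDualForm_tensor_tmul, h, multilinearDualForm_tensor_tmul]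

theorem multilinearOperatorForm_injective :
    Function.Injective (multilinearOperatorForm (Y := Y) β) := by
  intro S T h
  ext x
  refine (SeparatingDual.eq_iff_forall_dual_eq (R := 𝕜)).2 fun g => ?_
  rw [← multilinearOperatorForm_tensor_tmul, h, multilinearOperatorForm_tensor_tmul]

theorem multilinearDualForm_toOperator (v : Forms β ⊗[𝕜] StrongDual 𝕜 Y) :
    multilinearDualForm β (toOperator β (StrongDual 𝕜 Y) v) = evaluation β Y v := by
  suffices multilinearDualForm β ∘ₗ toOperator β (StrongDual 𝕜 Y) = evaluation β Y from
    LinearMap.congr_fun this v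
  refine TensorProduct.ext' fun φ g => LinearMap.ext_on_range (span_range_tensor_tmul β Y)
    fun p => ?_
  exact multilinearDualForm_tensor_tmul β (toOperator β _ (φ ⊗ₜ g)) p.1 p.2

theorem exists_incl_eq (u : CrossTensor β ⊗[𝕜] Y) :
    ∃ (E : ∀ i, FinSub 𝕜 (X i)) (F : FinSub 𝕜 Y) (w : CrossTensor (β.restrict E) ⊗[𝕜] F.1),
      incl β E F w = u := by
  obtain ⟨c, rfl⟩ := Finsupp.mem_span_range_iff_exists_finsupp.1
    (Submodule.eq_top_iff'.1 (span_range_tensor_tmul β Y) u)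
  let E : ∀ i, FinSub 𝕜 (X i) := fun i =>
    ⟨Submodule.span 𝕜 ((fun p : (∀ i, X i) × Y => p.1 i) '' c.support),
      FiniteDimensional.span_of_finite 𝕜 (c.support.finite_toSet.image _)⟩
  let F : FinSub 𝕜 Y := ⟨Submodule.span 𝕜 (Prod.snd '' (c.support : Set ((∀ i, X i) × Y))),
    FiniteDimensional.span_of_finite 𝕜 (c.support.finite_toSet.image _)⟩
  suffices (c.sum fun (p : (∀ i, X i) × Y) a => a • tensor β p.1 ⊗ₜ[𝕜] p.2) ∈
      LinearMap.range (incl β E F) from ⟨E, F, this⟩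
  refine Submodule.sum_mem _ fun (p : (∀ i, X i) × Y) hp => Submodule.smul_mem _ _ ?_
  have hx : ∀ i, p.1 i ∈ (E i).1 := fun i => Submodule.subset_span ⟨p, hp, rfl⟩
  have hy : p.2 ∈ F.1 := Submodule.subset_span ⟨p, hp, rfl⟩
  exact ⟨tensor (β.restrict E) (fun i => ⟨p.1 i, hx i⟩) ⊗ₜ ⟨p.2, hy⟩,
    congrArg (· ⊗ₜ p.2) (crossIncl_tensor β E _)⟩

end CrossTensor

/-! ### The tensor norm on spaces -/

section FinDual

variable {𝕜 : Type} [RCLike 𝕜] (ν : SigmaTensorNormOnDuals.{u} 𝕜) {n : ℕ} [NeZero n]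
  {X : Fin n → Type u} [∀ i, NormedAddCommGroup (X i)] [∀ i, NormedSpace 𝕜 (X i)]
  [∀ i, CompleteSpace (X i)] (β : ReasonableCrossnorm 𝕜 X) {F : Type u}
  [NormedAddCommGroup F] [NormedSpace 𝕜 F]

theorem norm_evaluation_tensor_tmul_le (v : Forms β ⊗[𝕜] StrongDual 𝕜 F) (x : ∀ i, X i)
    (y : F) :
    ‖evaluation β F v (tensor β x ⊗ₜ y)‖ ≤
      (∏ i, ‖x i‖) * ‖y‖ * ν.norm β (StrongDual 𝕜 F) v := by
  let J := NormedSpace.inclusionInDoubleDual 𝕜 F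
  have heval : evaluation β F v (tensor β x ⊗ₜ y) = evaluationAt (tensor β x - 0) (J y) v := by
    rw [sub_zero]
    induction v with
    | zero => simp only [map_zero, LinearMap.zero_apply]
    | add v v' h h' => simp only [map_add, LinearMap.add_apply, h, h']
    | tmul φ g => rfl
  rw [heval]
  refine (ν.evaluation_le β _ _ ⟨x, rfl⟩ 0 ⟨0, (tensor β).map_zero⟩ (J y) v).trans ?_
  rw [sub_zero]
  gcongr
  · exact norm_tensor_le β x
  · exact NormedSpace.double_dual_bound 𝕜 F y

theorem evaluation_flip_mem_boundedDual (w : CrossTensor β ⊗[𝕜] F) :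
    (evaluation β F).flip w ∈ boundedDual (𝕜 := 𝕜) (ν.norm β (StrongDual 𝕜 F)) := by
  suffices (boundedDual (𝕜 := 𝕜) (ν.norm β (StrongDual 𝕜 F))).comap (evaluation β F).flip = ⊤
    from Submodule.eq_top_iff'.1 this w
  rw [eq_top_iff, ← span_range_tensor_tmul, Submodule.span_le]
  rintro _ ⟨p, rfl⟩
  exact ⟨(∏ i, ‖p.1 i‖) * ‖p.2‖, by positivity,
    fun v => norm_evaluation_tensor_tmul_le ν β v p.1 p.2⟩

variable [CompleteSpace F] {G : Type u} [NormedAddCommGroup G] [NormedSpace 𝕜 G] [CompleteSpace G]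

theorem SigmaTensorNormOnDuals.norm_map_id_le (B : F →L[𝕜] G) (v : Forms β ⊗[𝕜] F) :
    ν.norm β G (TensorProduct.map LinearMap.id B.toLinearMap v) ≤ ‖B‖ * ν.norm β F v := by
  refine (ν.map_le β F β G (ContinuousLinearMap.id 𝕜 _) (fun q hq => ⟨q, hq, rfl⟩) B v).trans ?_
  gcongr
  exact mul_le_of_le_one_left (norm_nonneg B) ContinuousLinearMap.norm_id_le

theorem norm_evaluation_le (v : Forms β ⊗[𝕜] StrongDual 𝕜 F) (w : CrossTensor β ⊗[𝕜] F) :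
    ‖evaluation β F v w‖ ≤ ν.finDual β F w * ν.norm β (StrongDual 𝕜 F) v :=
  norm_le_dualNorm_mul (apply_nonneg _) (evaluation_flip_mem_boundedDual ν β w) v

theorem finDual_nonneg (w : CrossTensor β ⊗[𝕜] F) : 0 ≤ ν.finDual β F w :=
  dualNorm_nonneg _ _

theorem finDual_tensor_tmul_le (x : ∀ i, X i) (y : F) :
    ν.finDual β F (tensor β x ⊗ₜ y) ≤ (∏ i, ‖x i‖) * ‖y‖ :=
  dualNorm_le (by positivity) fun v => norm_evaluation_tensor_tmul_le ν β v x y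

theorem finDual_map_le (B : F →L[𝕜] G) (w : CrossTensor β ⊗[𝕜] F) :
    ν.finDual β G (TensorProduct.map LinearMap.id B.toLinearMap w) ≤ ‖B‖ * ν.finDual β F w := by
  have hw := finDual_nonneg ν β w
  refine dualNorm_le (by positivity) fun v => ?_
  have hB : ‖(ContinuousLinearMap.compL 𝕜 F G 𝕜).flip B‖ ≤ ‖B‖ :=
    ContinuousLinearMap.opNorm_le_bound _ (norm_nonneg B) fun g =>
      (g.opNorm_comp_le B).trans_eq (mul_comm _ _)
  calc _ = ‖evaluation β F _ w‖ := congrArg norm (evaluation_map β B v w)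
    _ ≤ ν.finDual β F w * _ := norm_evaluation_le ν β _ w
    _ ≤ ν.finDual β F w * (‖B‖ * ν.norm β (StrongDual 𝕜 G) v) := by
      gcongr
      exact (ν.norm_map_id_le β _ v).trans (by gcongr)
    _ = ‖B‖ * ν.finDual β F w * ν.norm β (StrongDual 𝕜 G) v := by ring

theorem norm_le_iff_forall_norm_evaluation_le [∀ i, FiniteDimensional 𝕜 (X i)]
    [FiniteDimensional 𝕜 F] (v : Forms β ⊗[𝕜] StrongDual 𝕜 F) {C : ℝ} (hC : 0 ≤ C) :
    ν.norm β (StrongDual 𝕜 F) v ≤ C ↔ ∀ w, ‖evaluation β F v w‖ ≤ C * ν.finDual β F w := by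
  refine ⟨fun h w => (norm_evaluation_le ν β v w).trans ?_, fun h => ?_⟩
  · rw [mul_comm]
    exact mul_le_mul_of_nonneg_right h (finDual_nonneg ν β w)
  · obtain ⟨ψ, hψv, hψ⟩ := exists_dual_apply_eq_seminorm (ν.norm β (StrongDual 𝕜 F)) v
    obtain ⟨w, rfl⟩ := evaluation_flip_surjective β ψ
    have hw : ν.finDual β F w ≤ 1 :=
      dualNorm_le zero_le_one fun v' => (hψ v').trans_eq (one_mul _).symm
    calc ν.norm β (StrongDual 𝕜 F) v = ‖evaluation β F v w‖ := by
          rw [← LinearMap.flip_apply, hψv, RCLike.norm_ofReal, abs_of_nonneg (apply_nonneg _ v)]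
      _ ≤ C * ν.finDual β F w := h w
      _ ≤ C := mul_le_of_le_one_right hC hw

end FinDual

section OnSpaces

variable {𝕜 : Type} [RCLike 𝕜] (ν : SigmaTensorNormOnDuals.{u} 𝕜) {n : ℕ} [NeZero n]
  {X : Fin n → Type u} [∀ i, NormedAddCommGroup (X i)] [∀ i, NormedSpace 𝕜 (X i)]
  (β : ReasonableCrossnorm 𝕜 X) {Y : Type u} [NormedAddCommGroup Y] [NormedSpace 𝕜 Y]
  [CompleteSpace Y]

theorem onSpaces_incl_le (E : ∀ i, FinSub 𝕜 (X i)) (F : FinSub 𝕜 Y)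
    (w : CrossTensor (β.restrict E) ⊗[𝕜] F.1) :
    ν.onSpaces β Y (incl β E F w) ≤ ν.finDual (β.restrict E) F.1 w := by
  refine csInf_le ⟨0, ?_⟩ ⟨E, F, w, rfl, rfl⟩
  rintro _ ⟨E, F, w, -, rfl⟩
  exact finDual_nonneg ν _ w

theorem forall_norm_le_onSpaces_iff (φ : Module.Dual 𝕜 (CrossTensor β ⊗[𝕜] Y)) {C : ℝ}
    (hC : 0 ≤ C) :
    (∀ u, ‖φ u‖ ≤ C * ν.onSpaces β Y u) ↔
      ∀ (E : ∀ i, FinSub 𝕜 (X i)) (F : FinSub 𝕜 Y) (w : CrossTensor (β.restrict E) ⊗[𝕜] F.1),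
        ‖φ (incl β E F w)‖ ≤ C * ν.finDual (β.restrict E) F.1 w := by
  refine ⟨fun h E F w => (h _).trans ?_, fun h u => ?_⟩
  · gcongr
    exact onSpaces_incl_le ν β E F w
  · obtain ⟨E, F, w, hw⟩ := exists_incl_eq β u
    rw [SigmaTensorNormOnDuals.onSpaces, ← smul_eq_mul C, ← Real.sInf_smul_of_nonneg hC]
    refine le_csInf (Set.Nonempty.smul_set ⟨_, E, F, w, hw, rfl⟩) ?_
    rintro _ ⟨_, ⟨E, F, w, rfl, rfl⟩, rfl⟩
    exact h E F w

theorem onSpaces_map_le (E : ∀ i, FinSub 𝕜 (X i)) {F : Type u} [NormedAddCommGroup F]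
    [NormedSpace 𝕜 F] [CompleteSpace F] [FiniteDimensional 𝕜 F] {R : F →ₗ[𝕜] Y} {C : ℝ}
    (hC : 0 ≤ C) (hR : ∀ f, ‖R f‖ ≤ C * ‖f‖) (w : CrossTensor (β.restrict E) ⊗[𝕜] F) :
    ν.onSpaces β Y (TensorProduct.map (crossIncl β E) R w) ≤
      C * ν.finDual (β.restrict E) F w := by
  let G : FinSub 𝕜 Y := ⟨LinearMap.range R, inferInstance⟩
  let B : F →L[𝕜] G.1 := R.rangeRestrict.mkContinuous C hR
  have hB : ‖B‖ ≤ C := LinearMap.mkContinuous_norm_le _ hC _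
  have hw : TensorProduct.map (crossIncl β E) R w =
      incl β E G (TensorProduct.map LinearMap.id B.toLinearMap w) := by
    rw [incl, ← LinearMap.comp_apply, ← TensorProduct.map_comp]; rfl
  rw [hw]
  refine (onSpaces_incl_le ν β E G _).trans ((finDual_map_le ν _ B w).trans ?_)
  exact mul_le_mul_of_nonneg_right hB (finDual_nonneg ν _ w)

theorem onSpaces_tensor_tmul_le (x : ∀ i, X i) (y : Y) :
    ν.onSpaces β Y (tensor β x ⊗ₜ y) ≤ (∏ i, ‖x i‖) * ‖y‖ := by
  let E : ∀ i, FinSub 𝕜 (X i) := fun i => ⟨Submodule.span 𝕜 {x i}, inferInstance⟩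
  let F : FinSub 𝕜 Y := ⟨Submodule.span 𝕜 {y}, inferInstance⟩
  let x' : ∀ i, (E i).1 := fun i => ⟨x i, Submodule.mem_span_singleton_self (x i)⟩
  let y' : F.1 := ⟨y, Submodule.mem_span_singleton_self y⟩
  have hincl : incl β E F (tensor (β.restrict E) x' ⊗ₜ y') = tensor β x ⊗ₜ y :=
    congrArg (· ⊗ₜ y) (crossIncl_tensor β E x')
  rw [← hincl]
  exact (onSpaces_incl_le ν β E F _).trans (finDual_tensor_tmul_le ν _ x' y')

end OnSpaces

/-! ### Finite codimensional subspaces as pre-annihilators -/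

section Preannihilator

variable {𝕜 : Type} [RCLike 𝕜] {Y : Type u} [NormedAddCommGroup Y] [NormedSpace 𝕜 Y]

/-- The common kernel in `Y` of the functionals in a finite dimensional subspace of `Y*`; it
parametrizes the closed finite codimensional subspaces of `Y`. -/
def preannihilator (F : FinSub 𝕜 (StrongDual 𝕜 Y)) : CofinSub 𝕜 Y :=
  ⟨LinearMap.ker F.1.subtypeL.flip.toLinearMap, ContinuousLinearMap.isClosed_ker F.1.subtypeL.flip,
    Module.Finite.equiv F.1.subtypeL.flip.toLinearMap.quotKerEquivRange.symm⟩

theorem mem_preannihilator_iff {F : FinSub 𝕜 (StrongDual 𝕜 Y)} {y : Y} :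
    y ∈ (preannihilator F).1 ↔ ∀ f ∈ F.1, f y = 0 :=
  LinearMap.mem_ker.trans
    ⟨fun h f hf => congrArg (fun g : StrongDual 𝕜 F.1 => g ⟨f, hf⟩) h,
      fun h => ContinuousLinearMap.ext fun f => h f f.2⟩

theorem mem_of_forall_preannihilator {F : FinSub 𝕜 (StrongDual 𝕜 Y)} {f : StrongDual 𝕜 Y}
    (hf : ∀ y ∈ (preannihilator F).1, f y = 0) : f ∈ F.1 := by
  let W : Submodule 𝕜 (Module.Dual 𝕜 Y) := F.1.map (ContinuousLinearMap.coeLM 𝕜)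
  have hfW : (f : Module.Dual 𝕜 Y) ∈ W := by
    rw [← Subspace.dualCoannihilator_dualAnnihilator_eq (W := W),
      Submodule.mem_dualAnnihilator]
    refine fun y hy => hf y (mem_preannihilator_iff.2 fun g hg => ?_)
    exact (Submodule.mem_dualCoannihilator y).1 hy _ ⟨g, hg, rfl⟩
  obtain ⟨g, hg, hgf⟩ := hfW
  exact ContinuousLinearMap.coe_injective hgf ▸ hg

theorem preannihilator_surjective :
    Function.Surjective (preannihilator : FinSub 𝕜 (StrongDual 𝕜 Y) → CofinSub 𝕜 Y) := by
  intro L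
  have : FiniteDimensional 𝕜 (Y ⧸ L.1) := L.2.2
  let D : StrongDual 𝕜 (Y ⧸ L.1) →L[𝕜] StrongDual 𝕜 Y :=
    (ContinuousLinearMap.compL 𝕜 Y (Y ⧸ L.1) 𝕜).flip L.1.mkQL
  let F : FinSub 𝕜 (StrongDual 𝕜 Y) := ⟨LinearMap.range D.toLinearMap, inferInstance⟩
  suffices (preannihilator F).1 = L.1 from ⟨F, Subtype.ext this⟩
  ext y
  calc y ∈ (preannihilator F).1 ↔ ∀ g : StrongDual 𝕜 (Y ⧸ L.1), g (Submodule.Quotient.mk y) = 0 :=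
        mem_preannihilator_iff.trans Set.forall_mem_range
    _ ↔ (Submodule.Quotient.mk y : Y ⧸ L.1) = 0 :=
        (SeparatingDual.eq_zero_iff_forall_dual_eq_zero (R := 𝕜) _).symm
    _ ↔ y ∈ L.1 := Submodule.Quotient.mk_eq_zero L.1

theorem norm_mk_preannihilator (F : FinSub 𝕜 (StrongDual 𝕜 Y)) (y : Y) :
    ‖(Submodule.Quotient.mk y : Y ⧸ (preannihilator F).1)‖ = ‖F.1.subtypeL.flip y‖ := by
  refine le_antisymm ?_ (QuotientAddGroup.le_norm_iff.2 fun z hz => ?_)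
  · obtain ⟨g, hg, hgy⟩ :=
      exists_dual_vector'' 𝕜 (Submodule.Quotient.mk y : Y ⧸ (preannihilator F).1)
    let f : F.1 := ⟨g.comp (preannihilator F).1.mkQL, mem_of_forall_preannihilator fun z hz =>
      (congrArg g ((Submodule.Quotient.mk_eq_zero _).2 hz)).trans (map_zero g)⟩
    have hf : ‖f‖ ≤ 1 := ContinuousLinearMap.opNorm_le_bound _ zero_le_one fun z =>
      (g.le_of_opNorm_le hg _).trans (by gcongr; exact Submodule.Quotient.norm_mk_le _ z)
    calc _ = ‖F.1.subtypeL.flip y f‖ := by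
          rw [← abs_norm, ← RCLike.norm_ofReal (K := 𝕜), ← hgy]; rfl
      _ ≤ ‖F.1.subtypeL.flip y‖ := (F.1.subtypeL.flip y).unit_le_opNorm f hf
  · have hzy : F.1.subtypeL.flip z = F.1.subtypeL.flip y :=
      LinearMap.sub_mem_ker_iff.1 ((Submodule.Quotient.eq (preannihilator F).1).1 hz)
    have hF : ‖F.1.subtypeL.flip‖ ≤ 1 :=
      (ContinuousLinearMap.opNorm_flip _).trans_le (Submodule.norm_subtypeL_le F.1)
    rw [← hzy]
    exact (F.1.subtypeL.flip.le_of_opNorm_le hF z).trans_eq (one_mul _)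

theorem subtypeL_flip_surjective (F : FinSub 𝕜 (StrongDual 𝕜 Y)) :
    Function.Surjective F.1.subtypeL.flip := by
  intro φ
  let B : F.1 →ₗ[𝕜] Module.Dual 𝕜 Y := ContinuousLinearMap.coeLM 𝕜 ∘ₗ F.1.subtype
  have hB : Function.Injective B :=
    ContinuousLinearMap.coe_injective.comp F.1.subtype_injective
  obtain ⟨y, hy⟩ := (LinearMap.flip_surjective_iff₁ (K := 𝕜) (V₁ := F.1)).2 hB φ.toLinearMap
  exact ⟨y, ContinuousLinearMap.coe_injective hy⟩

/-- The isometry `Y / L = F*` for the pre-annihilator `L` of a finite dimensional subspace `F` of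
`Y*`. -/
def quotientPreannihilatorEquiv (F : FinSub 𝕜 (StrongDual 𝕜 Y)) :
    (Y ⧸ (preannihilator F).1) ≃ₗᵢ[𝕜] StrongDual 𝕜 F.1 where
  toLinearEquiv := F.1.subtypeL.flip.toLinearMap.quotKerEquivOfSurjective
    (subtypeL_flip_surjective F)
  norm_map' q := by
    obtain ⟨y, rfl⟩ := Submodule.Quotient.mk_surjective _ q
    exact (norm_mk_preannihilator F y).symm

end Preannihilator

/-! ### Restrictions to finite dimensional subspaces -/

section Restriction

variable {𝕜 : Type} [RCLike 𝕜] {n : ℕ} {X : Fin n → Type u}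
  [∀ i, NormedAddCommGroup (X i)] [∀ i, NormedSpace 𝕜 (X i)] {Y : Type u}
  [NormedAddCommGroup Y] [NormedSpace 𝕜 Y] (β : ReasonableCrossnorm 𝕜 X)

/-- The restriction `E₁ × ⋯ × Eₙ → F*`, `x ↦ T(x)|_F`, of a multilinear operator into `Y*`. -/
def dualRestrict (T : ContinuousMultilinearMap 𝕜 X (StrongDual 𝕜 Y)) (E : ∀ i, FinSub 𝕜 (X i))
    (F : FinSub 𝕜 Y) : ContinuousMultilinearMap 𝕜 (fun i => (E i).1) (StrongDual 𝕜 F.1) :=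
  ((ContinuousLinearMap.compL 𝕜 F.1 Y 𝕜).flip F.1.subtypeL).compContinuousMultilinearMap
    (T.compContinuousLinearMap fun i => (E i).1.subtypeL)

theorem multilinearDualForm_dualRestrict (T : ContinuousMultilinearMap 𝕜 X (StrongDual 𝕜 Y))
    (E : ∀ i, FinSub 𝕜 (X i)) (F : FinSub 𝕜 Y) :
    multilinearDualForm (β.restrict E) (dualRestrict T E F) =
      multilinearDualForm β T ∘ₗ incl β E F := by
  refine LinearMap.ext_on_range (span_range_tensor_tmul (β.restrict E) F.1) fun p => ?_
  have hincl : incl β E F (tensor (β.restrict E) p.1 ⊗ₜ p.2) =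
      tensor β (fun i => (p.1 i : X i)) ⊗ₜ (p.2 : Y) :=
    congrArg (· ⊗ₜ (p.2 : Y)) (crossIncl_tensor β E p.1)
  rw [multilinearDualForm_tensor_tmul, LinearMap.comp_apply, hincl, multilinearDualForm_tensor_tmul]
  rfl

theorem multilinearDualForm_inclusionInDoubleDual_comp (T : ContinuousMultilinearMap 𝕜 X Y) :
    multilinearDualForm β
        ((NormedSpace.inclusionInDoubleDual 𝕜 Y).compContinuousMultilinearMap T) =
      multilinearOperatorForm β T := by
  refine LinearMap.ext_on_range (span_range_tensor_tmul β _) fun p => ?_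
  rw [multilinearDualForm_tensor_tmul, multilinearOperatorForm_tensor_tmul]
  rfl

theorem dualRestrict_eq_comp_localOperator (T : ContinuousMultilinearMap 𝕜 X Y)
    (E : ∀ i, FinSub 𝕜 (X i)) (F : FinSub 𝕜 (StrongDual 𝕜 Y)) :
    dualRestrict ((NormedSpace.inclusionInDoubleDual 𝕜 Y).compContinuousMultilinearMap T) E F =
      (quotientPreannihilatorEquiv F : (Y ⧸ (preannihilator F).1) →L[𝕜]
        StrongDual 𝕜 F.1).compContinuousMultilinearMap (localOperator T E (preannihilator F)) :=
  rfl

variable [NeZero n] (ν : SigmaTensorNormOnDuals.{u} 𝕜) [CompleteSpace Y]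

theorem forall_norm_multilinearOperatorForm_le_iff
    (T : ContinuousMultilinearMap 𝕜 X (StrongDual 𝕜 Y)) {C : ℝ} (hC : 0 ≤ C) :
    (∀ u, ‖multilinearOperatorForm β T u‖ ≤ C * ν.onSpaces β _ u) ↔
      ∀ u, ‖multilinearDualForm β T u‖ ≤ C * ν.onSpaces β Y u := by
  refine ⟨fun h => (forall_norm_le_onSpaces_iff ν β _ hC).2 fun E F w => ?_,
    fun h => (forall_norm_le_onSpaces_iff ν β _ hC).2 fun E F w => ?_⟩
  · let J : F.1 →ₗ[𝕜] StrongDual 𝕜 (StrongDual 𝕜 Y) :=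
      (NormedSpace.inclusionInDoubleDual 𝕜 Y).toLinearMap ∘ₗ F.1.subtype
    have hJ (f : F.1) : ‖J f‖ ≤ 1 * ‖f‖ :=
      (NormedSpace.double_dual_bound 𝕜 Y f).trans_eq (one_mul _).symm
    have hform : multilinearDualForm β T ∘ₗ incl β E F =
        multilinearOperatorForm β T ∘ₗ TensorProduct.map (crossIncl β E) J :=
      TensorProduct.ext' fun v f => rfl
    rw [← LinearMap.comp_apply, hform]
    refine (h _).trans (mul_le_mul_of_nonneg_left ?_ hC)
    exact (onSpaces_map_le ν β E zero_le_one hJ w).trans_eq (one_mul _)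
  · let w' : CrossTensor β ⊗[𝕜] F.1 := TensorProduct.map (crossIncl β E) .id w
    have hw' {Z : Type u} [AddCommGroup Z] [Module 𝕜 Z] (R : F.1 →ₗ[𝕜] Z) :
        TensorProduct.map .id R w' = TensorProduct.map (crossIncl β E) R w := by
      rw [← LinearMap.comp_apply, ← TensorProduct.map_comp]; rfl
    rw [incl, ← hw']
    refine norm_operatorForm_map_le_of_norm_dualForm_map_le (linearization β T)
      (mul_nonneg hC (finDual_nonneg ν _ w)) (fun R => ?_) F.1.subtype fun f => le_rfl
    rw [hw']
    refine (h _).trans ?_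
    rw [mul_assoc, mul_comm _ ‖R‖]
    gcongr
    exact onSpaces_map_le ν β E (norm_nonneg R) R.le_opNorm w

theorem exists_multilinearDualForm_eq_of_mem_boundedDual {φ : Module.Dual 𝕜 (CrossTensor β ⊗[𝕜] Y)}
    (hφ : φ ∈ boundedDual (𝕜 := 𝕜) (ν.onSpaces β Y)) :
    ∃ T : ContinuousMultilinearMap 𝕜 X (StrongDual 𝕜 Y), multilinearDualForm β T = φ := by
  obtain ⟨C, hC, h⟩ := hφ
  have hbound (x : ∀ i, X i) (y : Y) :
      ‖φ (tensor β x ⊗ₜ[𝕜] y)‖ ≤ C * (∏ i, ‖x i‖) * ‖y‖ := by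
    refine (h _).trans ?_
    rw [mul_assoc]
    gcongr
    exact onSpaces_tensor_tmul_le ν β x y
  let M : MultilinearMap 𝕜 X (StrongDual 𝕜 Y) :=
    { toFun x := (TensorProduct.curry φ (tensor β x)).mkContinuous (C * ∏ i, ‖x i‖) (hbound x)
      map_update_add' x i a b := ContinuousLinearMap.ext fun y => by
        change TensorProduct.curry φ (tensor β _) y =
          TensorProduct.curry φ (tensor β _) y + TensorProduct.curry φ (tensor β _) y
        rw [ContinuousMultilinearMap.map_update_add, map_add, LinearMap.add_apply]
      map_update_smul' x i c a := ContinuousLinearMap.ext fun y => by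
        change TensorProduct.curry φ (tensor β _) y = c • TensorProduct.curry φ (tensor β _) y
        rw [ContinuousMultilinearMap.map_update_smul, map_smul, LinearMap.smul_apply] }
  refine ⟨M.mkContinuous C fun x => LinearMap.mkContinuous_norm_le _ (by positivity) (hbound x),
    LinearMap.ext_on_range (span_range_tensor_tmul β Y) fun p => ?_⟩
  rw [multilinearDualForm_tensor_tmul]
  rfl

end Restriction

/-! ### `Σ`-ideals -/

section Ideal

variable {𝕜 : Type} [RCLike 𝕜] {A : SigmaIdeal.{u} 𝕜} {n : ℕ} [NeZero n] {X : Fin n → Type u}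
  [∀ i, NormedAddCommGroup (X i)] [∀ i, NormedSpace 𝕜 (X i)] [∀ i, CompleteSpace (X i)]
  {Y : Type u} [NormedAddCommGroup Y] [NormedSpace 𝕜 Y] [CompleteSpace Y]
  {β : ReasonableCrossnorm 𝕜 X} {T : ContinuousMultilinearMap 𝕜 X Y}

theorem SigmaIdeal.extNorm_of_mem (hT : T ∈ A.component β Y) :
    A.extNorm β T = ENNReal.ofReal (A.idealNorm β Y ⟨T, hT⟩) := dif_pos hT

theorem SigmaIdeal.extNorm_of_notMem (hT : T ∉ A.component β Y) : A.extNorm β T = ∞ :=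
  dif_neg hT

theorem SigmaIdeal.extNorm_ne_top_iff : A.extNorm β T ≠ ∞ ↔ T ∈ A.component β Y := by
  refine ⟨fun h => by_contra fun hT => h (extNorm_of_notMem hT), fun hT => ?_⟩
  rw [extNorm_of_mem hT]
  exact ENNReal.ofReal_ne_top

theorem SigmaIdeal.mem_component_iff_of_extNorm_le_iff {V : Type*} [AddCommGroup V] [Module 𝕜 V]
    {N : V → ℝ} {φ : Module.Dual 𝕜 V}
    (h : ∀ C, 0 ≤ C → (A.extNorm β T ≤ ENNReal.ofReal C ↔ ∀ u, ‖φ u‖ ≤ C * N u)) :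
    T ∈ A.component β Y ↔ φ ∈ boundedDual (𝕜 := 𝕜) N := by
  refine ⟨fun hT => ?_, fun ⟨C, hC, hφ⟩ => extNorm_ne_top_iff.1 ?_⟩
  · exact ⟨_, apply_nonneg _ _, (h _ (apply_nonneg _ _)).1 (extNorm_of_mem hT).le⟩
  · exact ne_top_of_le_ne_top ENNReal.ofReal_ne_top ((h C hC).2 hφ)

theorem SigmaIdeal.idealNorm_eq_dualNorm_of_extNorm_le_iff {V : Type*} [AddCommGroup V]
    [Module 𝕜 V] {N : V → ℝ} {φ : Module.Dual 𝕜 V} (hT : T ∈ A.component β Y)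
    (h : ∀ C, 0 ≤ C → (A.extNorm β T ≤ ENNReal.ofReal C ↔ ∀ u, ‖φ u‖ ≤ C * N u)) :
    A.idealNorm β Y ⟨T, hT⟩ = dualNorm N φ :=
  .symm <| dualNorm_eq_of_forall_le_iff (apply_nonneg _ _) fun C hC => by
    rw [← h C hC, extNorm_of_mem hT, ENNReal.ofReal_le_ofReal_iff hC]

variable {W : Type u} [NormedAddCommGroup W] [NormedSpace 𝕜 W] [CompleteSpace W]

theorem SigmaIdeal.extNorm_comp_le (A : SigmaIdeal.{u} 𝕜) (β : ReasonableCrossnorm 𝕜 X)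
    (T : ContinuousMultilinearMap 𝕜 X Y) {S : Y →L[𝕜] W} (hS : ‖S‖ ≤ 1) :
    A.extNorm β (S.compContinuousMultilinearMap T) ≤ A.extNorm β T := by
  by_cases hT : T ∈ A.component β Y
  · obtain ⟨U, hU, hle⟩ := A.comp_mem β Y β W (ContinuousLinearMap.id 𝕜 _)
      (fun q hq => hq) ⟨T, hT⟩ S
    have hUS : U.1 = S.compContinuousMultilinearMap T :=
      ContinuousMultilinearMap.ext fun x =>
        (hU x).trans (congrArg S (linearization_tensor β T x))
    rw [← hUS, extNorm_of_mem U.2, extNorm_of_mem hT]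
    refine ENNReal.ofReal_le_ofReal (hle.trans ?_)
    calc _ ≤ 1 * A.idealNorm β Y ⟨T, hT⟩ * 1 := by
          gcongr
          exact ContinuousLinearMap.norm_id_le
      _ = A.idealNorm β Y ⟨T, hT⟩ := by rw [one_mul, mul_one]
  · rw [extNorm_of_notMem hT]
    exact le_top

theorem SigmaIdeal.extNorm_linearIsometryEquiv_comp (A : SigmaIdeal.{u} 𝕜)
    (β : ReasonableCrossnorm 𝕜 X) (T : ContinuousMultilinearMap 𝕜 X Y) (J : Y ≃ₗᵢ[𝕜] W) :
    A.extNorm β ((J : Y →L[𝕜] W).compContinuousMultilinearMap T) = A.extNorm β T := by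
  refine (A.extNorm_comp_le β T J.toLinearIsometry.norm_toContinuousLinearMap_le).antisymm ?_
  have hT : (J.symm : W →L[𝕜] Y).compContinuousMultilinearMap
      ((J : Y →L[𝕜] W).compContinuousMultilinearMap T) = T :=
    ContinuousMultilinearMap.ext fun x => J.symm_apply_apply (T x)
  exact (congrArg (A.extNorm β) hT).symm.trans_le
    (A.extNorm_comp_le β _ J.symm.toLinearIsometry.norm_toContinuousLinearMap_le)

end Ideal

/-! ### The representation of maximal `Σ`-ideals -/

section Representation

variable {𝕜 : Type} [RCLike 𝕜] {ν : SigmaTensorNormOnDuals.{u} 𝕜} {A : SigmaIdeal.{u} 𝕜}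
  {n : ℕ} [NeZero n] {X : Fin n → Type u} [∀ i, NormedAddCommGroup (X i)]
  [∀ i, NormedSpace 𝕜 (X i)] {Y : Type u} [NormedAddCommGroup Y] [NormedSpace 𝕜 Y]
  [CompleteSpace Y]

theorem SigmaIdeal.IsAssociated.extNorm_toOperator (hass : A.IsAssociated ν)
    [∀ i, CompleteSpace (X i)] [∀ i, FiniteDimensional 𝕜 (X i)] [FiniteDimensional 𝕜 Y]
    (β : ReasonableCrossnorm 𝕜 X) (v : Forms β ⊗[𝕜] Y) :
    A.extNorm β (toOperator β Y v) = ENNReal.ofReal (ν.norm β Y v) := by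
  obtain ⟨Φ, hΦ⟩ := hass β Y
  obtain ⟨htoOperator, hnorm⟩ := hΦ v
  rw [← htoOperator, ← hnorm, extNorm_of_mem (Φ v).2]

theorem SigmaIdeal.IsAssociated.extNorm_le_iff_finDual (hass : A.IsAssociated ν)
    [∀ i, CompleteSpace (X i)] [∀ i, FiniteDimensional 𝕜 (X i)] [FiniteDimensional 𝕜 Y]
    (β : ReasonableCrossnorm 𝕜 X)
    (T : ContinuousMultilinearMap 𝕜 X (StrongDual 𝕜 Y)) {C : ℝ} (hC : 0 ≤ C) :
    A.extNorm β T ≤ ENNReal.ofReal C ↔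
      ∀ w, ‖multilinearDualForm β T w‖ ≤ C * ν.finDual β Y w := by
  obtain ⟨v, rfl⟩ := toOperator_surjective β T
  rw [hass.extNorm_toOperator, ENNReal.ofReal_le_ofReal_iff hC, multilinearDualForm_toOperator]
  exact norm_le_iff_forall_norm_evaluation_le ν β v hC

theorem SigmaIdeal.IsAssociated.forall_extNorm_dualRestrict_le_iff (hass : A.IsAssociated ν)
    (β : ReasonableCrossnorm 𝕜 X) (T : ContinuousMultilinearMap 𝕜 X (StrongDual 𝕜 Y)) {C : ℝ}
    (hC : 0 ≤ C) :
    (∀ E F, A.extNorm (β.restrict E) (dualRestrict T E F) ≤ ENNReal.ofReal C) ↔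
      ∀ u, ‖multilinearDualForm β T u‖ ≤ C * ν.onSpaces β Y u := by
  rw [forall_norm_le_onSpaces_iff ν β _ hC]
  refine forall₂_congr fun E F => ?_
  rw [hass.extNorm_le_iff_finDual _ _ hC, multilinearDualForm_dualRestrict]
  rfl

variable [∀ i, CompleteSpace (X i)]

theorem SigmaIdeal.IsMaximal.extNorm_eq_iSup_dualRestrict (hmax : A.IsMaximal)
    (β : ReasonableCrossnorm 𝕜 X) (T : ContinuousMultilinearMap 𝕜 X Y) :
    A.extNorm β T = ⨆ (E : ∀ i, FinSub 𝕜 (X i)) (F : FinSub 𝕜 (StrongDual 𝕜 Y)),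
      A.extNorm (β.restrict E) (Y := StrongDual 𝕜 F.1) (dualRestrict
        ((NormedSpace.inclusionInDoubleDual 𝕜 Y).compContinuousMultilinearMap T) E F) := by
  rw [hmax β Y T]
  refine iSup_congr fun E => ?_
  rw [← preannihilator_surjective.iSup_comp]
  refine iSup_congr fun F => ?_
  rw [dualRestrict_eq_comp_localOperator, A.extNorm_linearIsometryEquiv_comp]

theorem SigmaIdeal.IsMaximal.extNorm_le_iff_multilinearOperatorForm (hmax : A.IsMaximal)
    (hass : A.IsAssociated ν) (β : ReasonableCrossnorm 𝕜 X)
    (T : ContinuousMultilinearMap 𝕜 X Y) {C : ℝ} (hC : 0 ≤ C) :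
    A.extNorm β T ≤ ENNReal.ofReal C ↔
      ∀ u, ‖multilinearOperatorForm β T u‖ ≤ C * ν.onSpaces β (StrongDual 𝕜 Y) u := by
  rw [hmax.extNorm_eq_iSup_dualRestrict, ← multilinearDualForm_inclusionInDoubleDual_comp,
    ← hass.forall_extNorm_dualRestrict_le_iff β _ hC]
  simp only [iSup_le_iff]

theorem SigmaIdeal.IsMaximal.extNorm_le_iff_multilinearDualForm (hmax : A.IsMaximal)
    (hass : A.IsAssociated ν) (β : ReasonableCrossnorm 𝕜 X)
    (T : ContinuousMultilinearMap 𝕜 X (StrongDual 𝕜 Y)) {C : ℝ} (hC : 0 ≤ C) :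
    A.extNorm β T ≤ ENNReal.ofReal C ↔
      ∀ u, ‖multilinearDualForm β T u‖ ≤ C * ν.onSpaces β Y u :=
  (hmax.extNorm_le_iff_multilinearOperatorForm hass β T hC).trans
    (forall_norm_multilinearOperatorForm_le_iff β ν T hC)

theorem map_multilinearDualForm_component (hmax : A.IsMaximal) (hass : A.IsAssociated ν)
    (β : ReasonableCrossnorm 𝕜 X) :
    (A.component β (StrongDual 𝕜 Y)).map (multilinearDualForm β) =
      boundedDual (𝕜 := 𝕜) (ν.onSpaces β Y) := by
  have hmem (T : ContinuousMultilinearMap 𝕜 X (StrongDual 𝕜 Y)) :=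
    A.mem_component_iff_of_extNorm_le_iff fun C hC =>
      hmax.extNorm_le_iff_multilinearDualForm hass β T hC
  ext φ
  refine ⟨fun ⟨T, hT, hφ⟩ => hφ ▸ (hmem T).1 hT, fun hφ => ?_⟩
  obtain ⟨T, rfl⟩ := exists_multilinearDualForm_eq_of_mem_boundedDual β ν hφ
  exact ⟨T, (hmem T).2 hφ, rfl⟩

theorem map_multilinearOperatorForm_component (hmax : A.IsMaximal) (hass : A.IsAssociated ν)
    (β : ReasonableCrossnorm 𝕜 X) :
    (A.component β Y).map (multilinearOperatorForm β) =
      dualInterOperators β Y (ν.onSpaces β (StrongDual 𝕜 Y)) := by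
  have hmem (T : ContinuousMultilinearMap 𝕜 X Y) :=
    A.mem_component_iff_of_extNorm_le_iff fun C hC =>
      hmax.extNorm_le_iff_multilinearOperatorForm hass β T hC
  ext φ
  refine ⟨fun ⟨T, hT, hφ⟩ => hφ ▸ ⟨(hmem T).1 hT, T, multilinearOperatorForm_tensor_tmul β T⟩,
    fun ⟨hφ, T, hT⟩ => ?_⟩
  have hφT : multilinearOperatorForm β T = φ :=
    LinearMap.ext_on_range (span_range_tensor_tmul β _) fun p =>
      (multilinearOperatorForm_tensor_tmul β T p.1 p.2).trans (hT p.1 p.2).symm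
  exact ⟨T, (hmem T).2 (hφT ▸ hφ), hφT⟩

end Representation

end SigmaIdeals

end

theorem theorem5 {𝕜 : Type} [RCLike 𝕜]
    (ν : SigmaTensorNormOnDuals.{u} 𝕜) (A : SigmaIdeal.{u} 𝕜)
    (hmax : A.IsMaximal) (hass : A.IsAssociated ν)
    {n : ℕ} [NeZero n] {X : Fin n → Type u} [∀ i, NormedAddCommGroup (X i)]
    [∀ i, NormedSpace 𝕜 (X i)] [∀ i, CompleteSpace (X i)]
    {Y : Type u} [NormedAddCommGroup Y] [NormedSpace 𝕜 Y] [CompleteSpace Y]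
    (β : ReasonableCrossnorm 𝕜 X) :
    (∃ Φ : boundedDual (𝕜 := 𝕜) (ν.onSpaces β Y) ≃ₗ[𝕜] A.component β (StrongDual 𝕜 Y),
      (∀ φ x y, (Φ φ : ContinuousMultilinearMap 𝕜 X (StrongDual 𝕜 Y)) x y =
        φ.1 (tensor β x ⊗ₜ[𝕜] y)) ∧
      ∀ φ, A.idealNorm β (StrongDual 𝕜 Y) (Φ φ) = dualNorm (ν.onSpaces β Y) φ.1) ∧
    (∃ Ψ : dualInterOperators β Y (ν.onSpaces β (StrongDual 𝕜 Y)) ≃ₗ[𝕜] A.component β Y,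
      (∀ φ x (g : StrongDual 𝕜 Y), g ((Ψ φ : ContinuousMultilinearMap 𝕜 X Y) x) =
        φ.1 (tensor β x ⊗ₜ[𝕜] g)) ∧
      ∀ φ, A.idealNorm β Y (Ψ φ) = dualNorm (ν.onSpaces β (StrongDual 𝕜 Y)) φ.1) := by
  constructor
  · obtain ⟨Φ, hΦ⟩ := exists_linearEquiv_of_map_eq (multilinearDualForm_injective β)
      (map_multilinearDualForm_component hmax hass β (Y := Y))
    refine ⟨Φ, fun φ x y => ?_, fun φ => ?_⟩
    · rw [← hΦ φ, multilinearDualForm_tensor_tmul]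
    · rw [← hΦ φ]
      exact A.idealNorm_eq_dualNorm_of_extNorm_le_iff (Φ φ).2 fun C hC =>
        hmax.extNorm_le_iff_multilinearDualForm hass β _ hC
  · obtain ⟨Ψ, hΨ⟩ := exists_linearEquiv_of_map_eq (multilinearOperatorForm_injective β)
      (map_multilinearOperatorForm_component hmax hass β (Y := Y))
    refine ⟨Ψ, fun φ x g => ?_, fun φ => ?_⟩
    · rw [← hΨ φ, multilinearOperatorForm_tensor_tmul]
    · rw [← hΨ φ]
      exact A.idealNorm_eq_dualNorm_of_extNorm_le_iff (Ψ φ).2 fun C hC =>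
        hmax.extNorm_le_iff_multilinearOperatorForm hass β _ hC
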